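/- Let $\pi\colon X\to\operatorname{Spec}\mathbb Z$ be an arithmetic surface, i.e. $X$ is an integral regular scheme of dimension two, flat and projective over $\operatorname{Spec}\mathbb Z$. Let $\mathcal A$ be an Azumaya algebra on $X$: a sheaf of $\mathcal O_X$-algebras, locally free of finite rank as an $\mathcal O_X$-module, such that for every closed point $x\in X$ the fibre $\mathcal A(x)=\mathcal A\otimes_{\mathcal O_X}k(x)$ is a central simple $k(x)$-algebra. Let $\mathcal M,\mathcal N$ be Azumaya modules, i.e. coherent, locally projective left $\mathcal A$-modules (locally direct summands of $\mathcal A^n$). For a finitely generated abelian group $G$ with free part $F(G)=G/G_{\rm tors}$ of rank $r$ and torsion subgroup of order $a$, put $\det(G)=\Lambda^r F(G)\otimes_{\mathbb Z}\tfrac1a\mathbb Z$, and for a locally free sheaf $\mathcal E$ of finite rank on $X$ put $$\lambda(\mathcal E)=\det(H^0(X,\mathcal E))\otimes_{\mathbb Z}\det(H^1(X,\mathcal E))^{-1},$$ $$\lambda_{\mathcal A}(\mathcal M,\mathcal N)=\det(\operatorname{Hom}_{\mathcal A}(\mathcal M,\mathcal N))\otimes_{\mathbb Z}\det(\operatorname{Ext}^1_{\mathcal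 A}(\mathcal M,\mathcal N))^{-1},$$ where $\operatorname{Ext}^1_{\mathcal A}$ is taken in the category of sheaves of left $\mathcal A$-modules and $(\cdot)^{-1}$ denotes the dual. Then the sheaf $\mathcal Hom_{\mathcal A}(\mathcal M,\mathcal N)$ is a locally free $\mathcal O_X$-module of finite rank, and $$\lambda_{\mathcal A}(\mathcal M,\mathcal N)=\lambda(\mathcal Hom_{\mathcal A}(\mathcal M,\mathcal N))$$ in the sense of a canonical isomorphism: it is the isomorphism $\det(e_0)\otimes(\det(e_1)^{-1})^{\vee}$ induced by group isomorphisms $$e_0\colon\operatorname{Hom}_{\mathcal A}(\mathcal M,\mathcal N)\to H^0(X,\mathcal Hom_{\mathcal A}(\mathcal M,\mathcal N)),\qquad e_1\colon\operatorname{Ext}^1_{\mathcal A}(\mathcal M,\mathcal N)\to H^1(X,\mathcal Hom_{\mathcal A}(\mathcal M,\mathcal N)).$$ Here $e_0$ sends a homomorphism to the global section it defines. For every short exact sequence $0\to\mathcal N\to\mathcal P\to\mathcal Q\to0$ of $\mathcal A$-modules the induced sequence of sheaves $\mathcal Hom_{\mathcal A}(\mathcal M,-)$ is exact, and $e_1$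 carries the connecting homomorphism $\operatorname{Hom}_{\mathcal A}(\mathcal M,\mathcal Q)\to\operatorname{Ext}^1_{\mathcal A}(\mathcal M,\mathcal N)$ to the connecting homomorphism $H^0(X,\mathcal Hom_{\mathcal A}(\mathcal M,\mathcal Q))\to H^1(X,\mathcal Hom_{\mathcal A}(\mathcal M,\mathcal N))$, under the identification of $\operatorname{Hom}_{\mathcal A}(\mathcal M,\mathcal Q)$ with the global sections of $\mathcal Hom_{\mathcal A}(\mathcal M,\mathcal Q)$. -/

import Mathlib

open CategoryTheory AlgebraicGeometry TopologicalSpace Opposite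
open scoped TensorProduct

namespace AzumayaDet
universe u v w

/-- A (not necessarily commutative) sheaf of `𝒪_X`-algebras: a sheaf of rings together with a
homomorphism from `𝒪_X` with central image. -/
structure OAlgebra (X : Scheme.{u}) where
  sheaf : CategoryTheory.Sheaf (Opens.grothendieckTopology X) RingCat.{u}
  unit : X.ringCatSheaf ⟶ sheaf
  central : ∀ (U : X.Opens) (r : Γ(X, U)) (a : sheaf.obj.obj (op U)),
    Commute ((unit.hom.app (op U)).hom r) a

namespace OAlgebra
noncomputable section
variable {X : Scheme.{u}} (A : OAlgebra X)

/-- The category of sheaves of left `A`-modules. -/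
abbrev Mod := SheafOfModules.{u} A.sheaf

/-- The underlying `𝒪_X`-module of a left `A`-module. -/
def toOModules : A.Mod ⥤ X.Modules := SheafOfModules.restrictScalars A.unit

/-- The stalk `A_x`. -/
abbrev Stalk (x : X) : RingCat.{u} := TopCat.Presheaf.stalk (X := X.toTopCat) A.sheaf.obj x

/-- The stalk `𝒪_{X,x}` formed in commutative rings agrees with the one formed in rings. -/
def stalkForgetIso (X : Scheme.{u}) (x : X) :
    (forget₂ CommRingCat.{u} RingCat.{u}).obj (X.presheaf.stalk x) ≅
      TopCat.Presheaf.stalk (X := X.toTopCat) X.ringCatSheaf.obj x :=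
  preservesColimitIso (forget₂ CommRingCat.{u} RingCat.{u})
    ((OpenNhds.inclusion x).op ⋙ X.presheaf)

theorem germ_stalkForgetIso (x : X) (U : X.Opens) (hx : x ∈ U) :
    (forget₂ CommRingCat.{u} RingCat.{u}).map (X.presheaf.germ U x hx) ≫
      (stalkForgetIso X x).hom =
    TopCat.Presheaf.germ (X := X.toTopCat) X.ringCatSheaf.obj U x hx :=
  ι_preservesColimitIso_hom (forget₂ CommRingCat.{u} RingCat.{u})
    ((OpenNhds.inclusion x).op ⋙ X.presheaf) (op ⟨U, hx⟩)

/-- The structure map `𝒪_{X,x} → A_x`. -/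
def stalkUnit (x : X) : X.presheaf.stalk x →+* A.Stalk x :=
  ((stalkForgetIso X x).hom ≫
    (TopCat.Presheaf.stalkFunctor RingCat.{u} (X := X.toTopCat) x).map A.unit.hom).hom

theorem stalkUnit_germ (x : X) (U : X.Opens) (hx : x ∈ U) (r : Γ(X, U)) :
    A.stalkUnit x ((X.presheaf.germ U x hx).hom r) =
      (TopCat.Presheaf.germ (X := X.toTopCat) A.sheaf.obj U x hx).hom
        ((A.unit.hom.app (op U)).hom r) := by
  have h : (forget₂ CommRingCat.{u} RingCat.{u}).map (X.presheaf.germ U x hx) ≫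
      ((stalkForgetIso X x).hom ≫
        (TopCat.Presheaf.stalkFunctor RingCat.{u} (X := X.toTopCat) x).map A.unit.hom) =
      A.unit.hom.app (op U) ≫ TopCat.Presheaf.germ (X := X.toTopCat) A.sheaf.obj U x hx := by
    refine (Category.assoc _ _ _).symm.trans ?_
    refine Eq.trans ?_ (TopCat.Presheaf.stalkFunctor_map_germ (X := X.toTopCat) U x hx A.unit.hom)
    exact congrArg (· ≫ (TopCat.Presheaf.stalkFunctor RingCat.{u} (X := X.toTopCat) x).map
      A.unit.hom) (germ_stalkForgetIso x U hx)
  exact ConcreteCategory.congr_hom h r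

theorem stalkUnit_commute (x : X) (r : X.presheaf.stalk x) (a : A.Stalk x) :
    A.stalkUnit x r * a = a * A.stalkUnit x r := by
  obtain ⟨U, hU, r, rfl⟩ := TopCat.Presheaf.exists_germ_eq (X := X.toTopCat) X.presheaf r
  obtain ⟨V, hV, a, rfl⟩ := TopCat.Presheaf.exists_germ_eq (X := X.toTopCat) A.sheaf.obj a
  let W : X.Opens := U ⊓ V
  have hW : x ∈ W := ⟨hU, hV⟩
  have h1 : (X.presheaf.germ U x hU).hom r = (X.presheaf.germ W x hW).hom
      ((X.presheaf.map (homOfLE inf_le_left : W ⟶ U).op).hom r) :=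
    (TopCat.Presheaf.germ_res_apply X.presheaf _ _ _ _).symm
  have h2 : (TopCat.Presheaf.germ (X := X.toTopCat) A.sheaf.obj V x hV).hom a =
      (TopCat.Presheaf.germ (X := X.toTopCat) A.sheaf.obj W x hW).hom
      ((A.sheaf.obj.map (homOfLE inf_le_right : W ⟶ V).op).hom a) :=
    (TopCat.Presheaf.germ_res_apply (X := X.toTopCat) A.sheaf.obj _ _ _ _).symm
  change A.stalkUnit x ((X.presheaf.germ U x hU).hom r) *
      (TopCat.Presheaf.germ (X := X.toTopCat) A.sheaf.obj V x hV).hom a =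
    (TopCat.Presheaf.germ (X := X.toTopCat) A.sheaf.obj V x hV).hom a *
      A.stalkUnit x ((X.presheaf.germ U x hU).hom r)
  rw [h1, h2, stalkUnit_germ, ← map_mul, ← map_mul, (A.central _ _ _).eq]

instance (x : X) : Algebra (X.presheaf.stalk x) (A.Stalk x) :=
  (A.stalkUnit x).toAlgebra' (A.stalkUnit_commute x)

instance (x : X) : Algebra (X.presheaf.stalk x) (X.residueField x) :=
  (X.residue x).hom.toAlgebra

/-- The fibre `A(x) = A ⊗ k(x)`, a `k(x)`-algebra. -/
abbrev Fiber (x : X) : Type u := X.residueField x ⊗[X.presheaf.stalk x] A.Stalk x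

end
end OAlgebra

noncomputable section
variable {X : Scheme.{u}}

/-- Every point has an open neighbourhood `U` with `E|U ≅ 𝒪_U ^ n` for some `n`. -/
def IsLocallyFreeOfFiniteRank (E : X.Modules) : Prop :=
  ∀ x : X, ∃ U : X.Opens, x ∈ U ∧ ∃ n : ℕ,
    Nonempty (SheafOfModules.over (R := X.ringCatSheaf) E U ≅
      SheafOfModules.free (R := X.ringCatSheaf.over U) (ULift.{u} (Fin n)))

/-- `A` is an Azumaya algebra: locally free of (locally) finite rank over `𝒪_X`, with central simple
fibres at all closed points. -/
structure OAlgebra.IsAzumaya (A : OAlgebra X) : Prop where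
  locallyFree : IsLocallyFreeOfFiniteRank (A.toOModules.obj (SheafOfModules.unit A.sheaf))
  central_fiber : ∀ x : X, IsClosed ({x} : Set X) →
    Algebra.IsCentral (X.residueField x) (A.Fiber x)
  simple_fiber : ∀ x : X, IsClosed ({x} : Set X) → IsSimpleRing (A.Fiber x)

/-- `M` is a (coherent) locally projective left `A`-module, i.e. an Azumaya module: every point has an
open neighbourhood `U` such that `M|U` is a direct summand of `(A|U) ^ n` for some `n`. -/
def OAlgebra.IsAzumayaModule (A : OAlgebra X) (M : A.Mod) : Prop :=
  ∀ x : X, ∃ U : X.Opens, x ∈ U ∧ ∃ n : ℕ,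
    Nonempty (Retract (M.over U)
      (SheafOfModules.free (R := A.sheaf.over U) (ULift.{u} (Fin n))))

/-- `X` is projective over `Spec ℤ`: it has a closed immersion into some projective space `ℙⁿ_ℤ`.
Compatibility with the structure morphisms is automatic, as `Spec ℤ` is terminal. -/
def IsProjectiveOverInt (X : Scheme.{0}) : Prop :=
  ∃ n : ℕ,
    letI : GradedAlgebra (MvPolynomial.homogeneousSubmodule (Fin (n + 1)) ℤ) :=
      MvPolynomial.gradedAlgebra
    ∃ i : X ⟶ Proj (MvPolynomial.homogeneousSubmodule (Fin (n + 1)) ℤ),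
      IsClosedImmersion i

/-- `π : X ⟶ Spec ℤ` is an arithmetic surface: `X` is integral, regular, two-dimensional, and flat and
projective over `Spec ℤ`. -/
structure IsArithmeticSurface {X : Scheme.{0}} (π : X ⟶ Spec (CommRingCat.of ℤ)) : Prop where
  integral : IsIntegral X
  regular : ∀ x : X, IsRegularLocalRing (X.presheaf.stalk x)
  dim_eq_two : topologicalKrullDim X = 2
  flat : Flat π
  projective : IsProjectiveOverInt X


/-- `Hom_{A|U}(M|U, N|U)`. -/
abbrev HomOver {A : OAlgebra X} (M N : A.Mod) (U : X.Opens) : Type u := M.over U ⟶ N.over U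

namespace HomOver
variable {A : OAlgebra X} {M N : A.Mod} {U V : X.Opens}

/-- Value of a local homomorphism on a section over `W ⊆ U`. -/
def eval (φ : HomOver M N U) {W : X.Opens} (i : W ⟶ U) :
    M.val.obj (op W) →ₗ[A.sheaf.obj.obj (op W)] N.val.obj (op W) :=
  (φ.val.app (op (Over.mk i))).hom

theorem ext_eval {φ ψ : HomOver M N U}
    (h : ∀ (W : X.Opens) (i : W ⟶ U) (m : M.val.obj (op W)), φ.eval i m = ψ.eval i m) : φ = ψ := by
  apply SheafOfModules.hom_ext
  apply PresheafOfModules.hom_ext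
  rintro ⟨W⟩
  apply ModuleCat.hom_ext
  apply LinearMap.ext
  intro m
  exact h W.left W.hom m

theorem eval_naturality (φ : HomOver M N U) {W W' : X.Opens} (j : W' ⟶ W) (i : W ⟶ U)
    (m : M.val.obj (op W)) :
    φ.eval (j ≫ i) (M.val.map j.op m) = N.val.map j.op (φ.eval i m) :=
  PresheafOfModules.naturality_apply φ.val
    (Over.homMk j : Over.mk (j ≫ i) ⟶ Over.mk i).op m

/-- Construct a local homomorphism from compatible linear maps. -/
def mk (f : ∀ (W : X.Opens), (W ⟶ U) →
      (M.val.obj (op W) →ₗ[A.sheaf.obj.obj (op W)] N.val.obj (op W)))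
    (hf : ∀ (W W' : X.Opens) (j : W' ⟶ W) (i : W ⟶ U) (m : M.val.obj (op W)),
      f W' (j ≫ i) (M.val.map j.op m) = N.val.map j.op (f W i m)) : HomOver M N U where
  val :=
    { app := fun W => ModuleCat.ofHom (X := (M.over U).val.obj W) (Y := (N.over U).val.obj W)
        (f W.unop.left W.unop.hom)
      naturality := by
        rintro ⟨W⟩ ⟨W'⟩ ⟨j⟩
        ext m
        have e : W'.hom = j.left ≫ W.hom := Subsingleton.elim _ _
        refine Eq.trans ?_ (hf W.left W'.left j.left W.hom m)
        change f W'.left W'.hom (M.val.map j.left.op m) = _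
        rw [e] }

@[simp] theorem eval_mk (f hf) {W : X.Opens} (i : W ⟶ U) (m : M.val.obj (op W)) :
    (mk (M := M) (N := N) f hf).eval i m = f W i m := rfl

@[simp] theorem eval_add (φ ψ : HomOver M N U) {W : X.Opens} (i : W ⟶ U) (m : M.val.obj (op W)) :
    (φ + ψ).eval i m = φ.eval i m + ψ.eval i m := rfl

@[simp] theorem eval_zero {W : X.Opens} (i : W ⟶ U) (m : M.val.obj (op W)) :
    (0 : HomOver M N U).eval i m = 0 := rfl

/-- Restriction of local homomorphisms to a smaller open set. -/
def restrict (i : U ⟶ V) (φ : HomOver M N V) : HomOver M N U :=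
  ((SheafOfModules.overFunctorMap A.sheaf i).app M).inv ≫
    (SheafOfModules.overMap A.sheaf i).map φ ≫ ((SheafOfModules.overFunctorMap A.sheaf i).app N).hom

@[simp] theorem eval_restrict (i : U ⟶ V) (φ : HomOver M N V) {W : X.Opens} (j : W ⟶ U)
    (m : M.val.obj (op W)) : (restrict i φ).eval j m = φ.eval (j ≫ i) m := rfl

/-- The image in `A(W)` of a function on `U ⊇ W`. -/
def scalar (A : OAlgebra X) {W U : X.Opens} (i : W ⟶ U) : Γ(X, U) →+* A.sheaf.obj.obj (op W) :=
  (A.unit.hom.app (op W)).hom.comp (X.presheaf.map i.op).hom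

theorem scalar_commute {W U : X.Opens} (i : W ⟶ U) (r : Γ(X, U)) (a : A.sheaf.obj.obj (op W)) :
    scalar A i r * a = a * scalar A i r := A.central W _ a

theorem map_scalar {W' W U : X.Opens} (j : W' ⟶ W) (i : W ⟶ U) (r : Γ(X, U)) :
    A.sheaf.obj.map j.op (scalar A i r) = scalar A (j ≫ i) r := by
  have h := ConcreteCategory.congr_hom (A.unit.hom.naturality j.op) ((X.presheaf.map i.op).hom r)
  refine Eq.trans h.symm ?_
  change (A.unit.hom.app (op W')).hom ((X.presheaf.map j.op).hom ((X.presheaf.map i.op).hom r)) =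
    (A.unit.hom.app (op W')).hom ((X.presheaf.map (j ≫ i).op).hom r)
  rw [op_comp, X.presheaf.map_comp]
  rfl

instance : SMul Γ(X, U) (HomOver M N U) where
  smul r φ := mk (fun W i =>
      { toFun := fun m => scalar A i r • φ.eval i m
        map_add' := fun m m' => by rw [map_add, smul_add]
        map_smul' := fun a m => by
          rw [map_smul, RingHom.id_apply, smul_smul, smul_smul, scalar_commute] })
    (fun W W' j i m => by
      change scalar A (j ≫ i) r • φ.eval (j ≫ i) (M.val.map j.op m) =
        N.val.map j.op (scalar A i r • φ.eval i m)
      rw [eval_naturality, PresheafOfModules.map_smul, map_scalar]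
      rfl)

@[simp] theorem eval_smul (r : Γ(X, U)) (φ : HomOver M N U) {W : X.Opens} (i : W ⟶ U)
    (m : M.val.obj (op W)) : (r • φ).eval i m = scalar A i r • φ.eval i m := rfl

instance : Module Γ(X, U) (HomOver M N U) where
  one_smul φ := ext_eval fun W i m => by rw [eval_smul, map_one, one_smul]
  mul_smul r s φ := ext_eval fun W i m => by simp only [eval_smul, map_mul, mul_smul]
  smul_zero r := ext_eval fun W i m => by simp only [eval_smul, eval_zero, smul_zero]
  smul_add r φ ψ := ext_eval fun W i m => by simp only [eval_smul, eval_add, smul_add]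
  add_smul r s φ := ext_eval fun W i m => by simp only [eval_smul, eval_add, map_add, add_smul]
  zero_smul φ := ext_eval fun W i m => by simp only [eval_smul, eval_zero, map_zero, zero_smul]

end HomOver

variable {A : OAlgebra X}

/-- The presheaf of abelian groups `U ↦ Hom_{A|U}(M|U, N|U)`. -/
def homPresheaf (M N : A.Mod) : TopCat.Presheaf Ab.{u} X.toTopCat where
  obj U := AddCommGrpCat.of (HomOver M N U.unop)
  map i := AddCommGrpCat.ofHom
    { toFun := HomOver.restrict i.unop
      map_zero' := HomOver.ext_eval fun _ _ _ => rfl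
      map_add' := fun _ _ => HomOver.ext_eval fun _ _ _ => rfl }
  map_id U := by
    apply AddCommGrpCat.hom_ext
    apply AddMonoidHom.ext
    intro φ
    exact HomOver.ext_eval (A := A) (M := M) (N := N) fun _ _ _ => rfl
  map_comp i j := by
    apply AddCommGrpCat.hom_ext
    apply AddMonoidHom.ext
    intro φ
    exact HomOver.ext_eval (A := A) (M := M) (N := N) fun _ _ _ => rfl

/-- Forget linearity over `A`: a local homomorphism is a morphism of presheaves of groups. -/
def homPresheafι (M N : A.Mod) :
    homPresheaf M N ⋙ forget Ab.{u} ⟶ presheafHom M.val.presheaf N.val.presheaf where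
  app U := ↾fun φ : HomOver M N U.unop => (PresheafOfModules.toPresheaf _).map φ.val
  naturality _ _ _ := rfl

theorem homPresheaf_isSheaf (M N : A.Mod) :
    Presheaf.IsSheaf (Opens.grothendieckTopology X) (homPresheaf M N) := by
  rw [Presheaf.isSheaf_iff_isSheaf_forget _ _ (forget Ab.{u}), isSheaf_iff_isSheaf_of_type]
  intro U S hS x hx
  have hP := (isSheaf_iff_isSheaf_of_type _ _).1 (Presheaf.IsSheaf.hom M.val.presheaf _ N.isSheaf)
  let x' := Presieve.FamilyOfElements.map x (homPresheafι M N)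
  have hx' : x'.Compatible := Presieve.FamilyOfElements.Compatible.map _ hx
  obtain ⟨y, hy, -⟩ := hP S hS x' hx'
  have hy' := (PresheafHom.isAmalgamation_iff S x' hx' y).1 hy
  -- the glued morphism, on sections over `W ⊆ U`
  let g (W : X.Opens) (i : W ⟶ U) : M.val.obj (op W) →+ N.val.obj (op W) :=
    (y.app (op (Over.mk i))).hom
  have g_nat (W W' : X.Opens) (j : W' ⟶ W) (i : W ⟶ U) (m : M.val.obj (op W)) :
      g W' (j ≫ i) (M.val.map j.op m) = N.val.map j.op (g W i m) :=
    ConcreteCategory.congr_hom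
      (y.naturality (Over.homMk j : Over.mk (j ≫ i) ⟶ Over.mk i).op) m
  have g_eq (W : X.Opens) (i : W ⟶ U) (hi : S i) (m : M.val.obj (op W)) :
      g W i m = HomOver.eval (x i hi : HomOver M N W) (𝟙 W) m :=
    ConcreteCategory.congr_hom (hy' W i hi) m
  have g_smul (W : X.Opens) (i : W ⟶ U) (a : A.sheaf.obj.obj (op W)) (m : M.val.obj (op W)) :
      g W i (a • m) = a • g W i m := by
    apply N.isSheaf.isSeparated _ _ ((Opens.grothendieckTopology X).pullback_stable i hS)
    intro W' j hj
    change N.val.map j.op (g W i (a • m)) = N.val.map j.op (a • g W i m)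
    rw [← g_nat, PresheafOfModules.map_smul, PresheafOfModules.map_smul, ← g_nat]
    erw [g_eq W' (j ≫ i) hj, g_eq W' (j ≫ i) hj]
    exact map_smul _ _ _
  have lin : ∃ z : HomOver M N U, ∀ (W : X.Opens) (i : W ⟶ U) (m : M.val.obj (op W)),
      z.eval i m = g W i m :=
    ⟨HomOver.mk (fun W i => { g W i with map_smul' := g_smul W i }) g_nat, fun _ _ _ => rfl⟩
  obtain ⟨z, hz⟩ := lin
  refine ⟨z, ?_, ?_⟩
  · intro W i hi
    refine HomOver.ext_eval (A := A) (M := M) (N := N) fun W' j m => ?_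
    change z.eval (j ≫ i) m = _
    have h2 : HomOver.restrict j (x i hi : HomOver M N W) = x (j ≫ i) (S.downward_closed hi j) :=
      (Presieve.FamilyOfElements.comp_of_compatible S hx hi j).symm
    rw [hz, g_eq W' (j ≫ i) (S.downward_closed hi j), ← h2]
    rfl
  · have key : ∀ z' : HomOver M N U, (∀ (W : X.Opens) (i : W ⟶ U) (hi : S i),
        HomOver.restrict i z' = (x i hi : HomOver M N W)) → z' = z := by
      intro z' hz'
      refine HomOver.ext_eval fun W j m => ?_
      apply N.isSheaf.isSeparated _ _ ((Opens.grothendieckTopology X).pullback_stable j hS)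
      intro W' k hk
      change N.val.map k.op (z'.eval j m) = N.val.map k.op (z.eval j m)
      rw [← HomOver.eval_naturality, ← HomOver.eval_naturality]
      refine Eq.trans ?_ ((hz W' (k ≫ j) _).trans (g_eq W' (k ≫ j) hk _)).symm
      rw [← hz' W' (k ≫ j) hk]
      rfl
    exact fun z' hz' => key z' fun W i hi => hz' i hi

/-- The sheaf `ℋom_A(M, N)` as an `𝒪_X`-module. -/
def homSheaf (M N : A.Mod) : X.Modules :=
  letI (U : X.Opensᵒᵖ) : Module (X.ringCatSheaf.obj.obj U) ((homPresheaf M N).obj U) :=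
    inferInstanceAs (Module Γ(X, U.unop) (HomOver M N U.unop))
  show SheafOfModules X.ringCatSheaf from
  { val := PresheafOfModules.ofPresheaf (R := X.ringCatSheaf.obj) (homPresheaf M N)
      (fun U V i r φ => HomOver.ext_eval (A := A) (M := M) (N := N) fun W j m => by
        change HomOver.scalar A (j ≫ i.unop) r • HomOver.eval (φ : HomOver M N U.unop) _ m =
          HomOver.scalar A j ((X.presheaf.map i).hom r) •
            HomOver.eval (φ : HomOver M N U.unop) _ m
        congr 1
        change (A.unit.hom.app (op W)).hom _ = (A.unit.hom.app (op W)).hom _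
        rw [op_comp, X.presheaf.map_comp]
        rfl)
    isSheaf := homPresheaf_isSheaf M N }


theorem HomOver.eval_comp {M N P : A.Mod} {U : X.Opens} (φ : HomOver M N U) (ψ : N.over U ⟶ P.over U)
    {W : X.Opens} (i : W ⟶ U) (m : M.val.obj (op W)) :
    HomOver.eval (φ ≫ ψ : HomOver M P U) i m = HomOver.eval (ψ : HomOver N P U) i (φ.eval i m) :=
  rfl

/-- Postcomposition with `f : N ⟶ P` as a morphism `ℋom_A(M, N) ⟶ ℋom_A(M, P)`. -/
def homSheafMap (M : A.Mod) {N P : A.Mod} (f : N ⟶ P) :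
    (show SheafOfModules X.ringCatSheaf from homSheaf M N) ⟶
      (show SheafOfModules X.ringCatSheaf from homSheaf M P) where
  val := PresheafOfModules.homMk
    { app := fun U => AddCommGrpCat.ofHom
        { toFun := fun φ : HomOver M N U.unop => φ ≫ SheafOfModules.Hom.over f U.unop
          map_zero' := HomOver.ext_eval (A := A) (M := M) (N := P) fun W i m =>
            map_zero (f.val.app (op W)).hom
          map_add' := fun φ ψ => HomOver.ext_eval (A := A) (M := M) (N := P) fun W i m =>
            map_add (f.val.app (op W)).hom _ _ }
      naturality := fun U V i => by
        apply AddCommGrpCat.hom_ext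
        apply AddMonoidHom.ext
        intro φ
        exact HomOver.ext_eval (A := A) (M := M) (N := P) fun _ _ _ => rfl }
    (fun U r φ => HomOver.ext_eval (A := A) (M := M) (N := P) fun W i m =>
      map_smul (f.val.app (op W)).hom _ _)

/-- The functor `ℋom_A(M, -)` from `A`-modules to `𝒪_X`-modules. -/
def homFunctor (M : A.Mod) : A.Mod ⥤ X.Modules where
  obj N := homSheaf M N
  map f := homSheafMap M f
  map_id N := by
    apply SheafOfModules.hom_ext
    apply PresheafOfModules.hom_ext
    intro U
    apply ModuleCat.hom_ext
    apply LinearMap.ext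
    intro φ
    exact HomOver.ext_eval (A := A) (M := M) (N := N) fun _ _ _ => rfl
  map_comp {N P Q} f g := by
    apply SheafOfModules.hom_ext
    apply PresheafOfModules.hom_ext
    intro U
    apply ModuleCat.hom_ext
    apply LinearMap.ext
    intro φ
    exact HomOver.ext_eval (A := A) (M := M) (N := Q) fun _ _ _ => rfl

/-- The underlying sheaf of abelian groups of an `𝒪_X`-module. -/
def toAbSheaf (X : Scheme.{u}) :
    X.Modules ⥤ CategoryTheory.Sheaf (Opens.grothendieckTopology X) AddCommGrpCat.{u} :=
  SheafOfModules.toSheaf X.ringCatSheaf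

/-- Sheaf cohomology `Hⁱ(X, E)` of an `𝒪_X`-module. -/
abbrev Cohomology (E : X.Modules) (i : ℕ) : Type u := ((toAbSheaf X).obj E).H i

/-- The functor `ℋom_A(M, -)` from `A`-modules to sheaves of abelian groups. -/
def homAbFunctor (M : A.Mod) :
    A.Mod ⥤ CategoryTheory.Sheaf (Opens.grothendieckTopology X) AddCommGrpCat.{u} :=
  homFunctor M ⋙ toAbSheaf X

instance (M : A.Mod) : (homAbFunctor M).Additive where
  map_add {N P f g} := by
    apply Sheaf.hom_ext
    ext U φ
    exact HomOver.ext_eval (A := A) (M := M) (N := P) fun _ _ _ => rfl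

/-- `Hom_A(M, N) → H⁰(X, ℋom_A(M, N))`, sending a homomorphism to the global section it defines. -/
def homToH0 (M N : A.Mod) : (M ⟶ N) →+ Cohomology (homSheaf M N) 0 :=
  (Sheaf.H.equiv₀ ((toAbSheaf X).obj (homSheaf M N))
      (Limits.isTerminalTop : Limits.IsTerminal (⊤ : Opens X))).symm.toAddMonoidHom.comp
    { toFun := fun φ => (SheafOfModules.Hom.over φ (⊤ : X.Opens) : HomOver M N ⊤)
      map_zero' := HomOver.ext_eval (A := A) (M := M) (N := N) fun _ _ _ => rfl
      map_add' := fun _ _ => HomOver.ext_eval (A := A) (M := M) (N := N) fun _ _ _ => rfl }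

section Det
variable (G : Type v) [AddCommGroup G] {G' : Type w} [AddCommGroup G']

/-- The free part `F(G)`, realised as `G` modulo its torsion subgroup. -/
abbrev FreePart : Type v := G ⧸ Submodule.torsion ℤ G

/-- The order of the torsion subgroup. -/
def torsionOrder : ℕ := Nat.card (Submodule.torsion ℤ G)

/-- The top exterior power of the free part. -/
abbrev topExterior : Submodule ℤ (ExteriorAlgebra ℤ (FreePart G)) :=
  ⋀[ℤ]^(Module.finrank ℤ (FreePart G)) (FreePart G)

/-- The fractional ideal `(1/a)ℤ ⊆ ℚ`. -/
abbrev torsionLattice (a : ℕ) : Submodule ℤ ℚ := Submodule.span ℤ {(1 / a : ℚ)}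

/-- The determinant `det(G) = det(F(G)) ⊗ (1/a)ℤ` of a finitely generated abelian group `G`, where
`a` is the order of the torsion subgroup and `det(F(G))` the top exterior power of the free part. -/
abbrev detLine : Type v := topExterior G ⊗[ℤ] torsionLattice (torsionOrder G)

variable {G}

theorem torsion_map (e : G ≃+ G') :
    (Submodule.torsion ℤ G).map (e.toIntLinearEquiv : G →ₗ[ℤ] G') = Submodule.torsion ℤ G' := by
  ext y
  simp only [Submodule.mem_map, Submodule.mem_torsion_iff]
  constructor
  · rintro ⟨x, ⟨a, ha⟩, rfl⟩
    refine ⟨a, ?_⟩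
    have := congrArg e ha
    simpa [Submonoid.smul_def] using this
  · rintro ⟨a, ha⟩
    refine ⟨e.symm y, ⟨a, ?_⟩, by simp⟩
    have := congrArg e.symm ha
    simpa [Submonoid.smul_def] using this

/-- The isomorphism of free parts induced by an isomorphism of groups. -/
def freePartCongr (e : G ≃+ G') : FreePart G ≃ₗ[ℤ] FreePart G' :=
  Submodule.Quotient.equiv _ _ e.toIntLinearEquiv (torsion_map e)

theorem torsionOrder_congr (e : G ≃+ G') : torsionOrder G = torsionOrder G' :=
  Nat.card_congr
    (((e.toIntLinearEquiv).submoduleMap (Submodule.torsion ℤ G)).trans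
      (LinearEquiv.ofEq _ _ (torsion_map e))).toEquiv

/-- The isomorphism of exterior powers induced by a linear equivalence. -/
def exteriorPowerCongr {F : Type v} {F' : Type w} [AddCommGroup F] [AddCommGroup F'] (n : ℕ)
    (f : F ≃ₗ[ℤ] F') : ⋀[ℤ]^n F ≃ₗ[ℤ] ⋀[ℤ]^n F' :=
  LinearEquiv.ofLinearMap (exteriorPower.map n f.toLinearMap) (exteriorPower.map n f.symm.toLinearMap)
    (by rw [← exteriorPower.map_comp, f.comp_symm, exteriorPower.map_id])
    (by rw [← exteriorPower.map_comp, f.symm_comp, exteriorPower.map_id])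

/-- The isomorphism of determinant lines induced by an isomorphism of groups. -/
def detCongr (e : G ≃+ G') : detLine G ≃ₗ[ℤ] detLine G' :=
  TensorProduct.congr
    ((exteriorPowerCongr _ (freePartCongr e)).trans
      (LinearEquiv.ofEq _ _ (by rw [(freePartCongr e).finrank_eq])))
    (LinearEquiv.ofEq _ _ (by rw [torsionOrder_congr e]))

end Det

/-- The Ext groups are formed in the abelian category of all sheaves of left `A`-modules. -/
instance : HasExt.{u + 1} A.Mod := HasExt.standard _

/-- `Extⁱ_A(M, N)`. -/
abbrev ExtGroup (M N : A.Mod) (i : ℕ) : Type (u + 1) := Abelian.Ext.{u + 1} M N i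

/-- The determinant of cohomology `λ(E) = det H⁰(X, E) ⊗ det H¹(X, E)⁻¹`. -/
abbrev cohomologyDet (E : X.Modules) : Type u :=
  detLine (Cohomology E 0) ⊗[ℤ] Module.Dual ℤ (detLine (Cohomology E 1))

/-- The `A`-determinant of cohomology `λ_A(M, N) = det Hom_A(M, N) ⊗ det Ext¹_A(M, N)⁻¹`. -/
abbrev pairDet (M N : A.Mod) : Type (u + 1) :=
  detLine (M ⟶ N) ⊗[ℤ] Module.Dual ℤ (detLine (ExtGroup M N 1))

end
end AzumayaDet

/-!
The sheaf `ℋom_A(M, N)` is handled through finite dual bases: `M` is locally a direct summand of a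
finite free `A`-module exactly when locally there are sections `s k` and functionals `f k` with
`m = ∑ f k (m) • s k` (`DualBasis`). Dual bases of `M` and `N` over `A` and of `A` over `𝒪_X`
combine to one of `ℋom_A(M, N)` over `𝒪_X` (`DualBasis.hom`). The coordinates of the sections of a dual
basis form an idempotent matrix; at a point it splits as `Q * P` with `P * Q = 1`, because
projective modules over the local ring are free, and the splitting spreads out to a neighbourhood,
where it provides a basis. Hence `ℋom_A(M, N)` is locally free
(`isLocallyFreeOfFiniteRank_homSheaf`).

The isomorphism `e₀` is the evident one. For `e₁`, both `Ext¹_A(M, -)` and `H¹(X, ℋom_A(M, -))`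
are computed from an embedding of `N` in an injective `A`-module `I`, as cokernels of the same map
`Hom_A(M, I) → Hom_A(M, I / N)` (`Abelian.Ext.exists_addEquiv_one_of_effaceable`). Three facts
enter.

* There are enough injectives: sheaves of modules form a Grothendieck abelian category
  (`SheafOfModules.enoughInjectives`).
* `ℋom_A(M, -)` is exact, since a homomorphism from `M` into a quotient is lifted locally by
  lifting its values on a dual basis (`homAbFunctor_shortExact`).
* `ℋom_A(M, I)` is flasque for injective `I`, so that its first cohomology vanishes: a
  homomorphism `M|V → I|V` extends by zero to the subsheaf of `M` of sections vanishing near the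
  points outside `V`, and from there to `M` (`homAbFunctor_isFlasque`,
  `TopCat.Sheaf.IsFlasque.ext_one_eq_zero`).

Compatibility with connecting homomorphisms holds because every extension of `Q` by `N` maps to
the extension of `I / N` by `N`. The isomorphism of determinant lines is the one induced by `e₀`
and `e₁`.
-/

/-! ### Sheaves of modules: injectives, epimorphisms and free modules -/

namespace SheafOfModules
open CategoryTheory.Limits
universe u
variable {C : Type u} [SmallCategory C] {J : GrothendieckTopology C}
  (R : CategoryTheory.Sheaf J RingCat.{u}) [HasSheafify J AddCommGrpCat.{u}]
  [J.WEqualsLocallyBijective AddCommGrpCat.{u}]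

/-- Filtered colimits of presheaves of modules are exact, because they are computed on the
underlying presheaves of abelian groups. -/
theorem _root_.PresheafOfModules.hasExactColimitsOfShape (S : Cᵒᵖ ⥤ RingCat.{u})
    (K : Type u) [SmallCategory K] [IsFiltered K] :
    HasExactColimitsOfShape K (PresheafOfModules.{u} S) := by
  have : ReflectsFiniteLimits (PresheafOfModules.toPresheaf S) := ⟨fun _ _ _ => inferInstance⟩
  exact HasExactColimitsOfShape.domain_of_functor K (PresheafOfModules.toPresheaf S)

/-- Exactness of filtered colimits passes to sheaves, because sheafification is exact. -/
theorem ab5OfSize : AB5OfSize.{u, u} (SheafOfModules.{u} R) where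
  ofShape K _ _ := by
    have := PresheafOfModules.hasExactColimitsOfShape R.obj K
    exact (PresheafOfModules.sheafificationAdjunction (𝟙 R.obj)).hasExactColimitsOfShape K

/-- The coproduct of the sheaves of modules which represent the sections functors separates. -/
theorem hasSeparator : HasSeparator (SheafOfModules.{u} R) where
  hasSeparator := by
    let adj := PresheafOfModules.sheafificationAdjunction (𝟙 R.obj)
    let S (X : C) : SheafOfModules.{u} R :=
      (PresheafOfModules.sheafification (𝟙 R.obj)).obj
        ((PresheafOfModules.free R.obj).obj (yoneda.obj X))
    have hS : ObjectProperty.IsSeparating (.ofObj S) := by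
      intro F G f g hfg
      apply (SheafOfModules.forget R ⋙ PresheafOfModules.restrictScalars (𝟙 R.obj)).map_injective
      apply PresheafOfModules.hom_ext
      rintro ⟨X⟩
      apply ModuleCat.hom_ext
      apply LinearMap.ext
      intro m
      have h := congrArg (adj.homEquiv _ _)
        (hfg _ (ObjectProperty.ofObj_apply S X)
          ((adj.homEquiv _ _).symm (PresheafOfModules.freeYonedaEquiv.symm m)))
      rw [adj.homEquiv_naturality_right, adj.homEquiv_naturality_right,
        Equiv.apply_symm_apply] at h
      have h' := congrArg PresheafOfModules.freeYonedaEquiv h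
      rwa [PresheafOfModules.freeYonedaEquiv_comp, PresheafOfModules.freeYonedaEquiv_comp,
        Equiv.apply_symm_apply] at h'
    exact ⟨_, hS.isSeparator_coproduct⟩

theorem enoughInjectives : EnoughInjectives (SheafOfModules.{u} R) :=
  have := ab5OfSize R
  have := hasSeparator R
  have : IsGrothendieckAbelian.{u} (SheafOfModules.{u} R) := {}
  inferInstance

/-- An epimorphism of sheaves of modules is one of abelian sheaves: its cokernel as a presheaf has
zero sheafification, and sheafification commutes with forgetting the module structure. -/
instance : (toSheaf.{u} R).PreservesEpimorphisms where
  preserves {P Q} p _ := by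
    let adj := PresheafOfModules.sheafificationAdjunction (𝟙 R.obj)
    let U := SheafOfModules.forget R ⋙ PresheafOfModules.restrictScalars (𝟙 R.obj)
    let F := PresheafOfModules.sheafification (𝟙 R.obj)
    let T := ShortComplex.mk (U.map p) (cokernel.π (U.map p)) (cokernel.condition _)
    have hT : T.Exact := ShortComplex.exact_cokernel _
    have e : F.map (U.map p) ≫ adj.counit.app Q = adj.counit.app P ≫ p := adj.counit_naturality p
    have hp : Epi (F.map (U.map p)) := by
      have : F.map (U.map p) = adj.counit.app P ≫ p ≫ inv (adj.counit.app Q) := by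
        rw [← Category.assoc, ← e, Category.assoc, IsIso.hom_inv_id, Category.comp_id]
      rw [this]
      infer_instance
    have hz : F.map (cokernel.π (U.map p)) = 0 := by
      rw [← cancel_epi (F.map (U.map p)), ← F.map_comp, cokernel.condition, comp_zero]
      exact F.map_zero _ _
    let L := PresheafOfModules.toPresheaf R.obj ⋙ presheafToSheaf J AddCommGrpCat.{u}
    have hL : (T.map L).Exact := hT.map L
    have hz' : (T.map L).g = 0 :=
      (congrArg (toSheaf R).map hz).trans ((toSheaf R).map_zero _ _)
    have h : Epi ((toSheaf R).map (F.map (U.map p))) := hL.epi_f hz'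
    have : Epi ((toSheaf R).map (adj.counit.app P) ≫ (toSheaf R).map p) := by
      rw [← Functor.map_comp, ← e, Functor.map_comp]
      exact epi_comp _ _
    exact epi_of_epi ((toSheaf R).map (adj.counit.app P)) _

end SheafOfModules

namespace SheafOfModules
universe u v w
variable {C : Type u} [Category.{v} C] {J : GrothendieckTopology C}
  {R : CategoryTheory.Sheaf J RingCat.{w}} [HasWeakSheafify J AddCommGrpCat.{w}]
  [J.WEqualsLocallyBijective AddCommGrpCat.{w}]

theorem free_hom_ext {I : Type w} {M : SheafOfModules.{w} R} {f g : free (R := R) I ⟶ M}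
    (h : ∀ i, ιFree i ≫ f = ιFree i ≫ g) : f = g :=
  Limits.Cofan.IsColimit.hom_ext (isColimitFreeCofan _) _ _ h

theorem exists_free_desc {I : Type w} {M : SheafOfModules.{w} R} (f : I → (unit R ⟶ M)) :
    ∃ g : free I ⟶ M, ∀ i, ιFree i ≫ g = f i :=
  ⟨Limits.Cofan.IsColimit.desc (isColimitFreeCofan I) f,
    Limits.Cofan.IsColimit.fac (isColimitFreeCofan _) _⟩

end SheafOfModules

/-! ### Comparison of effaceable connecting homomorphisms -/

section
open CategoryTheory.Abelian
universe w w' v v' u u'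
variable {C : Type u} [Category.{v} C] [Abelian C] [HasExt.{w} C] [EnoughInjectives C]
  {D : Type u'} [Category.{v'} D] [Abelian D] [HasExt.{w'} D]

/-- If `F` is exact, `Hom(M, -)` agrees with `Ext⁰(Z, F -)`, and `Ext¹(Z, F I)` vanishes for
injective `I`, then `Ext¹(M, -)` agrees with `Ext¹(Z, F -)` compatibly with connecting
homomorphisms: both are effaceable `δ`-functors. -/
theorem CategoryTheory.Abelian.Ext.exists_addEquiv_one_of_effaceable (F : C ⥤ D)
    [F.Additive] (M : C) (Z : D)
    (α : ∀ N : C, (M ⟶ N) →+ Ext.{w'} Z (F.obj N) 0) (hα : ∀ N, Function.Bijective (α N))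
    (nat : ∀ {N P : C} (f : N ⟶ P) (φ : M ⟶ N),
      α P (φ ≫ f) = (α N φ).comp (Ext.mk₀ (F.map f)) (zero_add 0))
    (hF : ∀ {S : ShortComplex C}, S.ShortExact → (S.map F).ShortExact)
    (hI : ∀ I : C, Injective I → ∀ x : Ext.{w'} Z (F.obj I) 1, x = 0) (N : C) :
    ∃ e : Ext.{w} M N 1 ≃+ Ext.{w'} Z (F.obj N) 1,
      ∀ (P Q : C) (i : N ⟶ P) (p : P ⟶ Q) (h : i ≫ p = 0)
        (hS : (ShortComplex.mk i p h).ShortExact) (φ : M ⟶ Q),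
        e ((Ext.mk₀ φ).comp hS.extClass (zero_add 1)) =
          (α Q φ).comp (hF hS).extClass (zero_add 1) := by
  let T := ShortComplex.mk (Injective.ι N) (Limits.cokernel.π (Injective.ι N))
    (Limits.cokernel.condition _)
  have hT : T.ShortExact :=
    { exact := ShortComplex.exact_cokernel _
      mono_f := inferInstanceAs (Mono (Injective.ι N))
      epi_g := inferInstanceAs (Epi (Limits.cokernel.π (Injective.ι N))) }
  have hinj : Injective T.X₂ := inferInstanceAs (Injective (Injective.under N))
  let d : (M ⟶ T.X₃) →+ Ext.{w} M N 1 :=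
    (hT.extClass.postcomp M (zero_add 1)).comp
      (Ext.addEquiv₀ (X := M) (Y := T.X₃)).symm.toAddMonoidHom
  let d' : (M ⟶ T.X₃) →+ Ext.{w'} Z (F.obj N) 1 :=
    ((hF hT).extClass.postcomp Z (zero_add 1)).comp (α T.X₃)
  have d_apply (φ) : d φ = (Ext.mk₀ φ).comp hT.extClass (zero_add 1) := rfl
  have d'_apply (φ) : d' φ = (α _ φ).comp (hF hT).extClass (zero_add 1) := rfl
  have hd : Function.Surjective d := by
    intro x
    obtain ⟨y, hy⟩ := Ext.covariant_sequence_exact₁ M hT x (Ext.eq_zero_of_injective _) (zero_add 1)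
    obtain ⟨φ, rfl⟩ := Ext.addEquiv₀.symm.surjective y
    exact ⟨φ, hy⟩
  have hd' : Function.Surjective d' := by
    intro x
    obtain ⟨y, hy⟩ := Ext.covariant_sequence_exact₁ Z (hF hT) x (hI _ hinj _) (zero_add 1)
    obtain ⟨φ, rfl⟩ := (hα _).surjective y
    exact ⟨φ, hy⟩
  have hker : d.ker = d'.ker := by
    ext φ
    simp only [AddMonoidHom.mem_ker]
    constructor
    · intro h
      obtain ⟨y, hy⟩ := Ext.covariant_sequence_exact₃ M hT (Ext.mk₀ φ) (zero_add 1) h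
      obtain ⟨ψ, rfl⟩ := Ext.addEquiv₀.symm.surjective y
      have : ψ ≫ T.g = φ := by
        apply (Ext.mk₀_bijective _ _).injective
        rw [← hy]
        exact (Ext.mk₀_comp_mk₀ ψ T.g).symm
      rw [d'_apply, ← this, nat]
      refine (Ext.comp_assoc_of_second_deg_zero (α _ ψ) (Ext.mk₀ (T.map F).g) (hF hT).extClass
        (zero_add 1)).trans ?_
      exact (congrArg (fun t => (α _ ψ).comp t (zero_add 1)) (hF hT).comp_extClass).trans
        (Ext.comp_zero _ _ _ _ _)
    · intro h
      obtain ⟨y, hy⟩ := Ext.covariant_sequence_exact₃ Z (hF hT) (α _ φ) (zero_add 1) h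
      obtain ⟨ψ, rfl⟩ := (hα _).surjective y
      have : ψ ≫ T.g = φ := by
        apply (hα _).injective
        rw [nat]
        exact hy
      rw [d_apply, ← this, ← Ext.mk₀_comp_mk₀, Ext.comp_assoc_of_second_deg_zero, hT.comp_extClass,
        Ext.comp_zero]
  let e : Ext.{w} M N 1 ≃+ Ext.{w'} Z (F.obj N) 1 :=
    (QuotientAddGroup.quotientKerEquivOfSurjective d hd).symm.trans
      ((QuotientAddGroup.quotientAddEquivOfEq hker).trans
        (QuotientAddGroup.quotientKerEquivOfSurjective d' hd'))
  have he (φ) : e (d φ) = d' φ := by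
    have : (QuotientAddGroup.quotientKerEquivOfSurjective d hd).symm (d φ) = (φ : _ ⧸ d.ker) := by
      rw [AddEquiv.symm_apply_eq]; rfl
    change (QuotientAddGroup.quotientKerEquivOfSurjective d' hd')
      (QuotientAddGroup.quotientAddEquivOfEq hker
        ((QuotientAddGroup.quotientKerEquivOfSurjective d hd).symm (d φ))) = d' φ
    rw [this]
    rfl
  refine ⟨e, fun P Q i p h hS φ => ?_⟩
  have := hS.mono_f
  have := hS.epi_g
  -- every extension of `Q` by `N` is a pullback of the injective one
  let a : P ⟶ T.X₂ := Injective.factorThru (Injective.ι N) i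
  have ha : i ≫ a = T.f := Injective.comp_factorThru _ _
  let b : Q ⟶ T.X₃ := hS.exact.desc (a ≫ T.g) (by
    change i ≫ a ≫ T.g = 0
    rw [← Category.assoc, ha, T.zero])
  have hb : p ≫ b = a ≫ T.g := hS.exact.g_desc _ _
  let τ : ShortComplex.mk i p h ⟶ T :=
    { τ₁ := 𝟙 N, τ₂ := a, τ₃ := b
      comm₁₂ := (Category.id_comp _).trans ha.symm
      comm₂₃ := hb.symm }
  have h1 := ShortComplex.ShortExact.extClass_naturality hS hT τ
  have h2 := ShortComplex.ShortExact.extClass_naturality (hF hS) (hF hT) (F.mapShortComplex.map τ)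
  change hS.extClass.comp (Ext.mk₀ (𝟙 N)) (add_zero 1) = (Ext.mk₀ b).comp hT.extClass _ at h1
  change (hF hS).extClass.comp (Ext.mk₀ (F.map (𝟙 N))) (add_zero 1) =
    (Ext.mk₀ (F.map b)).comp (hF hT).extClass _ at h2
  rw [Ext.comp_mk₀_id] at h1
  rw [F.map_id] at h2
  have h2' := (Ext.comp_mk₀_id (hF hS).extClass).symm.trans h2
  have h3 : (Ext.mk₀ φ).comp hS.extClass (zero_add 1) = d (φ ≫ b) := by
    rw [h1, d_apply, ← Ext.mk₀_comp_mk₀, Ext.comp_assoc_of_second_deg_zero]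
  rw [h3, he, d'_apply, nat]
  exact (Ext.comp_assoc_of_second_deg_zero (α Q φ) (Ext.mk₀ (F.mapShortComplex.map τ).τ₃)
    (hF hT).extClass (zero_add 1)).trans
      (congrArg (fun t => (α Q φ).comp t (zero_add 1)) h2'.symm)
end

/-! ### Short exact sequences and flasque sheaves on a space -/

/-- A sequence of abelian sheaves on a space is short exact as soon as it is left exact on sections
and locally right exact. -/
theorem TopCat.Sheaf.shortExact_of_sections.{u} {X : TopCat.{u}}
    {S : ShortComplex (CategoryTheory.Sheaf (Opens.grothendieckTopology X) AddCommGrpCat.{u})}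
    (inj : ∀ (U : Opens X) (s : S.X₁.obj.obj (op U)), S.f.hom.app (op U) s = 0 → s = 0)
    (ex : ∀ (U : Opens X) (s : S.X₂.obj.obj (op U)), S.g.hom.app (op U) s = 0 →
      ∃ t : S.X₁.obj.obj (op U), S.f.hom.app (op U) t = s)
    (surj : ∀ (U : Opens X) (s : S.X₃.obj.obj (op U)), ∀ x ∈ U, ∃ (V : Opens X) (i : V ⟶ U),
      x ∈ V ∧ ∃ t : S.X₂.obj.obj (op V), S.g.hom.app (op V) t = S.X₃.obj.map i.op s) :
    S.ShortExact := by
  have inj' (U : Opens X) : Function.Injective (S.f.hom.app (op U)) :=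
    (injective_iff_map_eq_zero (S.f.hom.app (op U)).hom).2 (inj U)
  have mono : Mono S.f := by
    constructor
    intro K a b h
    apply CategoryTheory.Sheaf.hom_ext
    ext U s
    exact inj' U.unop (ConcreteCategory.congr_hom (congrArg (fun t => t.hom.app U) h) s)
  have epi : Epi S.g := by
    refine (TopCat.Sheaf.isLocallySurjective_iff_epi S.g).1 ?_
    rw [TopCat.Presheaf.isLocallySurjective_iff]
    intro U s x hx
    obtain ⟨V, i, hV, t, ht⟩ := surj U s x hx
    exact ⟨V, i.le, ⟨t, ht⟩, hV⟩
  refine { exact := ?_, mono_f := mono, epi_g := epi }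
  apply ShortComplex.exact_of_f_is_kernel
  refine Limits.KernelFork.IsLimit.ofι' S.f S.zero fun {K} k hk => ?_
  have hk' (U : (Opens X)ᵒᵖ) (s : K.obj.obj U) : S.g.hom.app U (k.hom.app U s) = 0 :=
    ConcreteCategory.congr_hom (congrArg (fun t => t.hom.app U) hk) s
  choose l hl using fun (U : (Opens X)ᵒᵖ) (s : K.obj.obj U) => ex U.unop _ (hk' U s)
  refine ⟨⟨NatTrans.mk (fun U => AddCommGrpCat.ofHom (AddMonoidHom.mk' (l U) fun s t =>
    inj' U.unop ?_)) fun U V i => ?_⟩, ?_⟩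
  · rw [map_add]
    refine (hl U _).trans ((map_add (k.hom.app U).hom s t).trans ?_)
    exact congrArg₂ (· + ·) (hl U s).symm (hl U t).symm
  · ext s
    apply inj' V.unop
    change S.f.hom.app V (l V (K.obj.map i s)) = S.f.hom.app V (S.X₁.obj.map i (l U s))
    rw [hl]
    have h1 := ConcreteCategory.congr_hom (S.f.hom.naturality i) (l U s)
    have h2 := ConcreteCategory.congr_hom (k.hom.naturality i) s
    refine h2.trans (Eq.trans ?_ h1.symm)
    exact congrArg (S.X₂.obj.map i) (hl U s).symm
  · apply CategoryTheory.Sheaf.hom_ext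
    ext U s
    exact hl U s

/-- Flasque sheaves have no first cohomology. -/
theorem TopCat.Sheaf.IsFlasque.ext_one_eq_zero.{u, w} {X : TopCat.{u}}
    (F : CategoryTheory.Sheaf (Opens.grothendieckTopology X) AddCommGrpCat.{u})
    [HasExt.{w} (CategoryTheory.Sheaf (Opens.grothendieckTopology X) AddCommGrpCat.{u})]
    (hF : TopCat.Sheaf.IsFlasque (X := X) F) (x : F.H 1) : x = 0 := by
  let T := ShortComplex.mk (Injective.ι F) (Limits.cokernel.π (Injective.ι F))
    (Limits.cokernel.condition _)
  have hT : T.ShortExact :=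
    { exact := ShortComplex.exact_cokernel _
      mono_f := inferInstanceAs (Mono (Injective.ι F))
      epi_g := inferInstanceAs (Epi (Limits.cokernel.π (Injective.ι F))) }
  have hinj : Injective T.X₂ := inferInstanceAs (Injective (Injective.under F))
  obtain ⟨y, hy⟩ := Abelian.Ext.covariant_sequence_exact₁ _ hT x
    (Abelian.Ext.eq_zero_of_injective _) (zero_add 1)
  have top : Limits.IsTerminal (⊤ : Opens X) := Limits.isTerminalTop
  have hs : Epi (T.g.hom.app (op ⊤)) :=
    haveI : TopCat.Sheaf.IsFlasque (X := X) T.X₁ := hF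
    TopCat.Sheaf.IsFlasque.epi_of_shortExact (X := X) (U := ⊤) (S := T) hT
  obtain ⟨s, hs⟩ := (AddCommGrpCat.epi_iff_surjective _).1 hs
    (CategoryTheory.Sheaf.H.equiv₀ T.X₃ top y)
  have h := CategoryTheory.Sheaf.H.equiv₀_symm_naturality top T.g s
  rw [hs, AddEquiv.symm_apply_apply] at h
  rw [← hy, ← h, CategoryTheory.Sheaf.H.map_apply, Abelian.Ext.comp_assoc_of_second_deg_zero,
    hT.comp_extClass, Abelian.Ext.comp_zero]

/-! ### Idempotent matrices over local rings -/

/-- An idempotent matrix over a local ring splits through a free module. -/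
theorem Matrix.exists_mul_eq_of_isIdempotentElem {R : Type*} [CommRing R] [IsLocalRing R]
    {ι : Type*} [Fintype ι] [DecidableEq ι] (e : Matrix ι ι R) (he : e * e = e) :
    ∃ (n : ℕ) (Q : Matrix ι (Fin n) R) (P : Matrix (Fin n) ι R), Q * P = e ∧ P * Q = 1 := by
  let f := Matrix.toLin' e
  have hf (v) : f (f v) = f v := by
    rw [← LinearMap.comp_apply, ← Matrix.toLin'_mul, he]
  let V := LinearMap.range f
  have hproj : Module.Projective R V := by
    refine Module.Projective.of_split V.subtype f.rangeRestrict ?_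
    ext ⟨v, w, hw⟩ : 2
    simp only [LinearMap.comp_apply, Submodule.subtype_apply, LinearMap.id_apply,
      LinearMap.codRestrict_apply]
    change f v = v
    rw [← hw, hf]
  have hfree : Module.Free R V := Module.free_of_flat_of_isLocalRing
  let b := Module.finBasis R V
  let q : (Fin (Module.finrank R V) → R) →ₗ[R] (ι → R) := V.subtype ∘ₗ b.equivFun.symm.toLinearMap
  let p : (ι → R) →ₗ[R] (Fin (Module.finrank R V) → R) := b.equivFun.toLinearMap ∘ₗ f.rangeRestrict
  refine ⟨Module.finrank R V, LinearMap.toMatrix' q, LinearMap.toMatrix' p, ?_, ?_⟩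
  · rw [← LinearMap.toMatrix'_comp, ← LinearMap.toMatrix'_toLin' e]
    congr 1
    ext1
    ext1
    simp [q, p, f]
  · rw [← LinearMap.toMatrix'_comp, ← LinearMap.toMatrix'_id]
    congr 1
    have key (v : V) : f.rangeRestrict v = v := by
      obtain ⟨v, w, rfl⟩ := v
      exact Subtype.ext (hf w)
    refine LinearMap.ext fun v => ?_
    change b.equivFun (f.rangeRestrict (b.equivFun.symm v : V)) = v
    rw [key, LinearEquiv.apply_symm_apply]

namespace AzumayaDet
universe u
noncomputable section
variable {X : Scheme.{u}} {A : OAlgebra X}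

/-! ### Sections, functionals and dual bases -/

/-- The restriction map `M(U) → M(W)`. -/
def res {M : A.Mod} {W U : X.Opens} (i : W ⟶ U) (m : M.val.obj (op U)) : M.val.obj (op W) :=
  M.val.map i.op m

section res
variable {M N : A.Mod} {W' W U : X.Opens}

@[simp] theorem res_add (i : W ⟶ U) (m m' : M.val.obj (op U)) :
    res i (m + m') = res i m + res i m' := map_add (M.val.presheaf.map i.op).hom m m'

@[simp] theorem res_zero (i : W ⟶ U) : res i (0 : M.val.obj (op U)) = 0 :=
  map_zero (M.val.presheaf.map i.op).hom

theorem res_sum {ι : Type*} (t : Finset ι) (i : W ⟶ U) (m : ι → M.val.obj (op U)) :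
    res i (∑ k ∈ t, m k) = ∑ k ∈ t, res i (m k) := map_sum (M.val.presheaf.map i.op).hom m t

theorem res_smul (i : W ⟶ U) (a : A.sheaf.obj.obj (op U)) (m : M.val.obj (op U)) :
    res i (a • m) = (A.sheaf.obj.map i.op a : A.sheaf.obj.obj (op W)) • res i m :=
  PresheafOfModules.map_smul _ _ _ _

theorem res_res (j : W' ⟶ W) (i : W ⟶ U) (m : M.val.obj (op U)) :
    res j (res i m) = res (j ≫ i) m := by
  unfold res
  rw [op_comp, PresheafOfModules.map_comp_apply]

@[simp] theorem res_id (m : M.val.obj (op U)) : res (𝟙 U) m = m := by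
  unfold res
  rw [op_id, PresheafOfModules.map_id]
  rfl

/-- Naturality of a local homomorphism, with the composite inclusion `W' ⟶ U` written in any way. -/
theorem HomOver.eval_res (φ : HomOver M N U) (j : W' ⟶ W) (i : W ⟶ U) (i' : W' ⟶ U)
    (m : M.val.obj (op W)) : φ.eval i' (res j m) = res j (φ.eval i m) := φ.eval_naturality j i m

end res

namespace HomOver
variable {M : A.Mod} {U : X.Opens}

/-- The values of a local functional `M|U → A|U`. -/
def coord (f : HomOver M (SheafOfModules.unit A.sheaf) U) {W : X.Opens} (i : W ⟶ U) :
    M.val.obj (op W) →ₗ[A.sheaf.obj.obj (op W)] A.sheaf.obj.obj (op W) :=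
  f.eval i

theorem coord_naturality (f : HomOver M (SheafOfModules.unit A.sheaf) U) {W W' : X.Opens}
    (j : W' ⟶ W) (i : W ⟶ U) (m : M.val.obj (op W)) :
    f.coord (j ≫ i) (res j m) = A.sheaf.obj.map j.op (f.coord i m) :=
  f.eval_naturality j i m

/-- A local homomorphism out of `A` is determined by the image of `1`. -/
theorem eval_unit (σ : HomOver (SheafOfModules.unit A.sheaf) M U) {W : X.Opens} (i : W ⟶ U)
    (a : A.sheaf.obj.obj (op W)) :
    σ.eval i a = a • res i (σ.eval (𝟙 U) (1 : A.sheaf.obj.obj (op U))) := by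
  have h1 : res (M := SheafOfModules.unit A.sheaf) i (1 : A.sheaf.obj.obj (op U)) =
      (1 : A.sheaf.obj.obj (op W)) := map_one (A.sheaf.obj.map i.op).hom
  have h2 := (σ.eval_res i (𝟙 U) i (1 : A.sheaf.obj.obj (op U))).symm.trans
    (congrArg (σ.eval i) h1)
  have h3 := (σ.eval i).map_smul a (1 : A.sheaf.obj.obj (op W))
  rw [h2]
  exact (congrArg (σ.eval i) (mul_one a).symm).trans h3

/-- The local homomorphism `A|U → M|U` sending `1` to a given section. -/
def ofSection (s : M.val.obj (op U)) : HomOver (SheafOfModules.unit A.sheaf) M U :=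
  mk (fun W i => LinearMap.toSpanSingleton (A.sheaf.obj.obj (op W)) (M.val.obj (op W)) (res i s))
    (fun W W' j i a => by
      refine Eq.trans ?_ (res_smul (M := M) j (show A.sheaf.obj.obj (op W) from a) (res i s)).symm
      rw [res_res]
      rfl)

theorem eval_sum {N : A.Mod} {ι : Type*} (t : Finset ι) (φ : ι → HomOver M N U) {W : X.Opens}
    (i : W ⟶ U) (m : M.val.obj (op W)) : (∑ k ∈ t, φ k).eval i m = ∑ k ∈ t, (φ k).eval i m := by
  induction t using Finset.cons_induction with
  | empty => simp
  | cons a t ha ih => rw [Finset.sum_cons, Finset.sum_cons, eval_add, ih]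

end HomOver

/-- A finite dual basis of `M` over `U`: sections `s k` and functionals `f k` with
`m = ∑ f k (m) • s k`, so that `M|U` is a direct summand of a finite free `A|U`-module. -/
structure DualBasis (ι : Type) [Fintype ι] (M : A.Mod) (U : X.Opens) where
  /-- The generating sections. -/
  s : ι → M.val.obj (op U)
  /-- The coordinate functionals. -/
  f : ι → HomOver M (SheafOfModules.unit A.sheaf) U
  sum_smul : ∀ {W : X.Opens} (i : W ⟶ U) (m : M.val.obj (op W)),
    ∑ k, (f k).coord i m • res i (s k) = m

namespace DualBasis
variable {ι : Type} [Fintype ι] {M : A.Mod} {U : X.Opens}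

/-- Restriction of a dual basis to a smaller open set. -/
def restrict (b : DualBasis ι M U) {V : X.Opens} (j : V ⟶ U) : DualBasis ι M V where
  s k := res j (b.s k)
  f k := (b.f k).restrict j
  sum_smul {W} i m := by
    refine Eq.trans ?_ (b.sum_smul (i ≫ j) m)
    refine Finset.sum_congr rfl fun k _ => ?_
    rw [res_res]
    rfl

/-- A direct summand of a finite free module has a dual basis. -/
def ofRetract {n : ℕ} (r : Retract (M.over U)
      (SheafOfModules.free (R := A.sheaf.over U) (ULift.{u} (Fin n)))) :
    DualBasis (Fin n) M U :=
  let p (k : ULift.{u} (Fin n)) : SheafOfModules.free (R := A.sheaf.over U) (ULift.{u} (Fin n)) ⟶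
      SheafOfModules.unit (A.sheaf.over U) :=
    (SheafOfModules.exists_free_desc (fun l => if l = k then 𝟙 _ else 0)).choose
  have p_apply (l k : ULift.{u} (Fin n)) :
      SheafOfModules.ιFree l ≫ p k = if l = k then 𝟙 _ else 0 :=
    (SheafOfModules.exists_free_desc (fun l => if l = k then 𝟙 _ else 0)).choose_spec l
  have hp : ∑ k, p k ≫ SheafOfModules.ιFree k = 𝟙 _ := by
    refine SheafOfModules.free_hom_ext fun l => ?_
    rw [Preadditive.comp_sum, Finset.sum_eq_single l]
    · rw [← Category.assoc, p_apply]
      simp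
    · intro k _ hk
      rw [← Category.assoc, p_apply, if_neg hk.symm, Limits.zero_comp]
    · simp
  let σ (k : Fin n) : HomOver (SheafOfModules.unit A.sheaf) M U :=
    SheafOfModules.ιFree (R := A.sheaf.over U) (ULift.up k) ≫ r.r
  let f (k : Fin n) : HomOver M (SheafOfModules.unit A.sheaf) U := r.i ≫ p (ULift.up k)
  { s := fun k => (σ k).eval (𝟙 U) (1 : A.sheaf.obj.obj (op U))
    f := f
    sum_smul := fun {W} i m => by
      have h : ∑ k, (f k ≫ σ k : HomOver M M U) = 𝟙 (M.over U) := by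
        rw [← r.retract, ← Category.id_comp r.r, ← hp, Preadditive.sum_comp, Preadditive.comp_sum,
          ← Equiv.ulift.{u}.sum_comp]
        refine Finset.sum_congr rfl fun k _ => ?_
        change (r.i ≫ p k) ≫ SheafOfModules.ιFree k ≫ r.r = _
        simp only [Category.assoc]
      have h' := congrArg (fun φ : HomOver M M U => φ.eval i m) h
      refine Eq.trans ?_ h'
      refine Eq.trans ?_ (HomOver.eval_sum _ _ i m).symm
      refine Finset.sum_congr rfl fun k _ => ?_
      exact ((σ k).eval_unit i _).symm }

/-- If the coordinates of the sections of a dual basis are those of the standard basis, then the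
module is free. -/
theorem nonempty_iso_free {n : ℕ} (b : DualBasis (Fin n) M U)
    (hb : ∀ k l, (b.f k).coord (𝟙 U) (b.s l) = if l = k then 1 else 0) :
    Nonempty (M.over U ≅ SheafOfModules.free (R := A.sheaf.over U) (ULift.{u} (Fin n))) := by
  let τ (l : Fin n) : SheafOfModules.unit (A.sheaf.over U) ⟶ M.over U := HomOver.ofSection (b.s l)
  let φ (k : Fin n) : M.over U ⟶ SheafOfModules.unit (A.sheaf.over U) := b.f k
  let F : M.over U ⟶ SheafOfModules.free (R := A.sheaf.over U) (ULift.{u} (Fin n)) :=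
    ∑ k : Fin n, φ k ≫ SheafOfModules.ιFree (ULift.up k)
  obtain ⟨G, hG⟩ : ∃ G : SheafOfModules.free (R := A.sheaf.over U) (ULift.{u} (Fin n)) ⟶ M.over U,
      ∀ l, SheafOfModules.ιFree l ≫ G = τ l.down :=
    SheafOfModules.exists_free_desc _
  refine ⟨⟨F, G, ?_, ?_⟩⟩
  · rw [Preadditive.sum_comp]
    refine HomOver.ext_eval (A := A) (M := M) (N := M) fun W i m => ?_
    refine (HomOver.eval_sum (A := A) (M := M) (N := M) _ _ i m).trans ?_
    refine Eq.trans ?_ (b.sum_smul i m)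
    refine Finset.sum_congr rfl fun k _ => ?_
    rw [Category.assoc, hG]
    rfl
  · refine SheafOfModules.free_hom_ext fun l => ?_
    rw [Category.comp_id, ← Category.assoc, hG, Preadditive.comp_sum]
    have h (k : Fin n) : τ l.down ≫ φ k = if l.down = k then 𝟙 _ else 0 := by
      refine HomOver.ext_eval (A := A) (M := SheafOfModules.unit A.sheaf)
        (N := SheafOfModules.unit A.sheaf) fun W i a => ?_
      refine (HomOver.eval_comp (A := A) (M := SheafOfModules.unit A.sheaf) (N := M)
        (P := SheafOfModules.unit A.sheaf) (HomOver.ofSection (b.s l.down)) (b.f k) i a).trans ?_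
      change (b.f k).coord i ((show A.sheaf.obj.obj (op W) from a) • res i (b.s l.down)) = _
      rw [map_smul]
      have := (b.f k).coord_naturality i (𝟙 U) (b.s l.down)
      rw [Category.comp_id] at this
      rw [this, hb]
      split_ifs
      · rw [map_one, smul_eq_mul, mul_one]; rfl
      · rw [map_zero, smul_zero]; rfl
    rw [Finset.sum_eq_single l.down]
    · rw [← Category.assoc, h, if_pos rfl]
      exact Category.id_comp _
    · intro k _ hk
      rw [← Category.assoc, h, if_neg hk.symm, Limits.zero_comp]
    · simp

end DualBasis

/-! ### Exactness of `ℋom_A(M, -)` for locally projective `M` -/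

/-- Forgetting the action of `A` is exact. -/
theorem shortExact_toSheaf {S : ShortComplex A.Mod} (hS : S.ShortExact) :
    (S.map (SheafOfModules.toSheaf A.sheaf)).ShortExact := by
  have := hS.mono_f
  have := hS.epi_g
  exact
    { exact := hS.exact.map_of_mono_of_preservesKernel _ inferInstance inferInstance
      mono_f := inferInstanceAs (Mono ((SheafOfModules.toSheaf A.sheaf).map S.f))
      epi_g := inferInstanceAs (Epi ((SheafOfModules.toSheaf A.sheaf).map S.g)) }

/-- The map on sections induced by a homomorphism of `A`-modules. -/
def app {M N : A.Mod} (f : M ⟶ N) (U : X.Opens) :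
    M.val.obj (op U) →ₗ[A.sheaf.obj.obj (op U)] N.val.obj (op U) := (f.val.app (op U)).hom

theorem app_res {M N : A.Mod} (f : M ⟶ N) {W U : X.Opens} (i : W ⟶ U) (m : M.val.obj (op U)) :
    app f W (res i m) = res i (app f U m) := PresheafOfModules.naturality_apply f.val i.op m

theorem app_injective {M N : A.Mod} (f : M ⟶ N) [Mono f] (U : X.Opens) :
    Function.Injective (app f U) := by
  have : Mono ((SheafOfModules.evaluation A.sheaf (op U)).map f) := inferInstance
  exact (ModuleCat.mono_iff_injective _).1 this

theorem exists_app_eq {S : ShortComplex A.Mod} (hS : S.ShortExact) {U : X.Opens}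
    (m : S.X₂.val.obj (op U)) (h : app S.g U m = 0) : ∃ l, app S.f U l = m :=
  TopCat.Sheaf.sections_exact_of_left_exact (X := X.toTopCat) (shortExact_toSheaf hS).exact
    (shortExact_toSheaf hS).mono_f m h

theorem exists_app_eq_res {M N : A.Mod} (f : M ⟶ N) [Epi f] {U : X.Opens}
    (m : N.val.obj (op U)) (x : X) (hx : x ∈ U) :
    ∃ (V : X.Opens) (i : V ⟶ U), x ∈ V ∧ ∃ l, app f V l = res i m := by
  have h : Epi ((SheafOfModules.toSheaf A.sheaf).map f) := inferInstance
  obtain ⟨V, i, ⟨l, hl⟩, hV⟩ := (TopCat.Presheaf.isLocallySurjective_iff _).1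
    ((TopCat.Sheaf.isLocallySurjective_iff_epi (X := X.toTopCat) _).2 h) U m x hx
  exact ⟨V, homOfLE i, hV, l, hl⟩

/-- Finitely many sections of a quotient lift simultaneously in a neighbourhood of a point. -/
theorem exists_forall_app_eq_res {M N : A.Mod} (f : M ⟶ N) [Epi f] {ι : Type*} [Finite ι]
    {U : X.Opens} (m : ι → N.val.obj (op U)) (x : X) (hx : x ∈ U) :
    ∃ (V : X.Opens) (i : V ⟶ U), x ∈ V ∧
      ∃ l : ι → M.val.obj (op V), ∀ k, app f V (l k) = res i (m k) := by
  choose V i hV l hl using fun k => exists_app_eq_res f (m k) x hx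
  cases nonempty_fintype ι
  refine ⟨U ⊓ Finset.univ.inf V, homOfLE inf_le_left, ⟨hx, ?_⟩,
    fun k => res (homOfLE (inf_le_right.trans (Finset.inf_le (Finset.mem_univ k)))) (l k),
    fun k => ?_⟩
  · rw [TopologicalSpace.Opens.coe_finset_inf]
    simp [hV]
  · rw [app_res, hl, res_res]
    rfl

theorem DualBasis.eval_eq {ι : Type} [Fintype ι] {M N : A.Mod} {U : X.Opens} (b : DualBasis ι M U)
    (φ : HomOver M N U) {W : X.Opens} (i : W ⟶ U) (m : M.val.obj (op W)) :
    φ.eval i m = ∑ k, (b.f k).coord i m • res i (φ.eval (𝟙 U) (b.s k)) := by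
  conv_lhs => rw [← b.sum_smul i m, map_sum]
  refine Finset.sum_congr rfl fun k _ => ?_
  rw [map_smul, ← φ.eval_res i (𝟙 U) i]

/-- The homomorphism `m ↦ ∑ f k (m) • n k`. It sends `s k` to `n k` only if the `n k` satisfy the
relations between the `s k`. -/
def DualBasis.lift {ι : Type} [Fintype ι] {M N : A.Mod} {U : X.Opens} (b : DualBasis ι M U)
    (n : ι → N.val.obj (op U)) : HomOver M N U :=
  ∑ k, ((b.f k) ≫ HomOver.ofSection (n k) : HomOver M N U)

theorem DualBasis.eval_lift {ι : Type} [Fintype ι] {M N : A.Mod} {U : X.Opens} (b : DualBasis ι M U)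
    (n : ι → N.val.obj (op U)) {W : X.Opens} (i : W ⟶ U) (m : M.val.obj (op W)) :
    (b.lift n).eval i m = ∑ k, (b.f k).coord i m • res i (n k) :=
  HomOver.eval_sum _ _ i m

/-- Locally, the module has a finite dual basis. -/
def IsLocallyProjective (M : A.Mod) : Prop :=
  ∀ x : X, ∃ (U : X.Opens) (n : ℕ), x ∈ U ∧ Nonempty (DualBasis (Fin n) M U)

theorem OAlgebra.IsAzumayaModule.isLocallyProjective {M : A.Mod}
    (hM : A.IsAzumayaModule M) : IsLocallyProjective M := fun x => by
  obtain ⟨U, hU, n, ⟨r⟩⟩ := hM x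
  exact ⟨U, n, hU, ⟨DualBasis.ofRetract r⟩⟩

/-- `ℋom_A(M, -)` is exact: a homomorphism into a quotient lifts locally because it is determined
by its values on a finite dual basis, which lift simultaneously. -/
theorem homAbFunctor_shortExact {M : A.Mod} (hM : IsLocallyProjective M)
    {S : ShortComplex A.Mod} (hS : S.ShortExact) : (S.map (homAbFunctor M)).ShortExact := by
  have := hS.mono_f
  have := hS.epi_g
  refine TopCat.Sheaf.shortExact_of_sections (X := X.toTopCat) ?_ ?_ ?_
  · intro U φ h
    refine HomOver.ext_eval (A := A) (M := M) (N := S.X₁) fun W i m => ?_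
    apply app_injective S.f W
    refine Eq.trans ?_ (map_zero (app S.f W)).symm
    exact congrArg (fun ψ : HomOver M S.X₂ U => ψ.eval i m) h
  · intro U (φ : HomOver M S.X₂ U) h
    have h' (W : X.Opens) (i : W ⟶ U) (m) : app S.g W (φ.eval i m) = 0 :=
      congrArg (fun ψ : HomOver M S.X₃ U => ψ.eval i m) h
    choose l hl using fun (W : X.Opens) (i : W ⟶ U) (m : M.val.obj (op W)) =>
      exists_app_eq hS _ (h' W i m)
    refine ⟨HomOver.mk (M := M) (N := S.X₁) (fun W i =>
      { toFun := l W i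
        map_add' := fun m m' => app_injective S.f W (by simp only [hl, map_add])
        map_smul' := fun a m => app_injective S.f W (by
          simp only [hl, map_smul, RingHom.id_apply]) }) ?_, ?_⟩
    · intro W W' j i m
      apply app_injective S.f W'
      refine (hl _ _ _).trans (Eq.trans ?_ (app_res S.f j (l W i m)).symm)
      rw [hl]
      exact φ.eval_naturality j i m
    · exact HomOver.ext_eval (A := A) (M := M) (N := S.X₂) fun W i m => hl W i m
  · intro U (φ : HomOver M S.X₃ U) x hx
    obtain ⟨U', n, hU', ⟨b⟩⟩ := hM x
    let b' := b.restrict (homOfLE inf_le_right : U ⊓ U' ⟶ U')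
    obtain ⟨V, j, hV, l, hl⟩ := exists_forall_app_eq_res S.g
      (fun k => φ.eval (homOfLE inf_le_left) (b'.s k)) x (⟨hx, hU'⟩ : x ∈ U ⊓ U')
    refine ⟨V, j ≫ homOfLE inf_le_left, hV, (b'.restrict j).lift l, ?_⟩
    refine HomOver.ext_eval (A := A) (M := M) (N := S.X₃) fun W i m => ?_
    change app S.g W (((b'.restrict j).lift l).eval i m) =
      (HomOver.restrict (j ≫ homOfLE inf_le_left) φ).eval i m
    rw [DualBasis.eval_lift, (b'.restrict j).eval_eq, map_sum]
    refine Finset.sum_congr rfl fun k _ => ?_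
    rw [map_smul, app_res, hl]
    congr 2
    exact (φ.eval_res j (homOfLE inf_le_left) _ (b'.s k)).symm

/-! ### Extension by zero, and local homomorphisms into injective modules -/

section extendByZero
variable {M N : A.Mod}

theorem eq_of_locally_eq {U : X.Opens} (m m' : M.val.obj (op U))
    (h : ∀ x ∈ U, ∃ (W : X.Opens) (i : W ⟶ U), x ∈ W ∧ res i m = res i m') : m = m' := by
  choose W i hW hi using fun x : U => h x.1 x.2
  exact TopCat.Sheaf.eq_of_locally_eq' (X := X.toTopCat) ⟨M.val.presheaf, M.isSheaf⟩ W U i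
    (fun x hx => Opens.mem_iSup.2 ⟨⟨x, hx⟩, hW _⟩) m m' hi

theorem exists_glue {ι : Type u} {U : X.Opens} {W : ι → X.Opens} (i : ∀ k, W k ⟶ U)
    (hU : ∀ x ∈ U, ∃ k, x ∈ W k) (m : ∀ k, M.val.obj (op (W k)))
    (h : ∀ k l, res (homOfLE inf_le_left : W k ⊓ W l ⟶ W k) (m k) =
      res (homOfLE inf_le_right : W k ⊓ W l ⟶ W l) (m l)) :
    ∃ s : M.val.obj (op U), ∀ k, res (i k) s = m k :=
  let m' (k : ι) : ToType (M.val.presheaf.obj (op (W k))) := m k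
  (TopCat.Sheaf.existsUnique_gluing' (X := X.toTopCat) ⟨M.val.presheaf, M.isSheaf⟩ W U i
    (fun x hx => Opens.mem_iSup.2 (hU x hx)) m' (fun k l => h k l)).exists

/-- The sections which vanish near every point outside `V`. -/
def supportedSubmodule (M : A.Mod) (V : X.Opens) : PresheafOfModules.Submodule M.val where
  obj W :=
    { carrier := {m | ∀ x ∈ W.unop, x ∈ V ∨ ∃ (W' : X.Opens) (i : W' ⟶ W.unop), x ∈ W' ∧
        res i (show M.val.obj (op W.unop) from m) = 0}
      zero_mem' := fun x hx => Or.inr ⟨W.unop, 𝟙 _, hx, res_zero _⟩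
      add_mem' := fun {m m'} hm hm' x hx => by
        rcases hm x hx with h | ⟨W₁, i₁, h₁, e₁⟩
        · exact Or.inl h
        rcases hm' x hx with h | ⟨W₂, i₂, h₂, e₂⟩
        · exact Or.inl h
        refine Or.inr ⟨W₁ ⊓ W₂, homOfLE inf_le_left ≫ i₁, ⟨h₁, h₂⟩, ?_⟩
        have e₁' := congrArg (res (homOfLE inf_le_left : W₁ ⊓ W₂ ⟶ W₁)) e₁
        have e₂' := congrArg (res (homOfLE inf_le_right : W₁ ⊓ W₂ ⟶ W₂)) e₂
        rw [res_res, res_zero] at e₁' e₂'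
        refine (res_add _ _ _).trans ?_
        rw [e₁', zero_add]
        exact e₂'
      smul_mem' := fun a m hm x hx => by
        rcases hm x hx with h | ⟨W₁, i₁, h₁, e₁⟩
        · exact Or.inl h
        refine Or.inr ⟨W₁, i₁, h₁, (res_smul i₁ _ _).trans ?_⟩
        rw [e₁, smul_zero] }
  map {W W'} i m hm x hx := by
    rcases hm x (i.unop.le hx) with h | ⟨W₁, i₁, h₁, e₁⟩
    · exact Or.inl h
    refine Or.inr ⟨W₁ ⊓ W'.unop, homOfLE inf_le_right, ⟨h₁, hx⟩, ?_⟩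
    have e₁' := congrArg (res (homOfLE inf_le_left : W₁ ⊓ W'.unop ⟶ W₁)) e₁
    rw [res_res, res_zero] at e₁'
    refine (res_res _ i.unop (show M.val.obj (op W.unop) from m)).trans ?_
    exact e₁'

theorem mem_supportedSubmodule {V W : X.Opens} {m : M.val.obj (op W)} :
    m ∈ (supportedSubmodule M V).obj (op W) ↔ ∀ x ∈ W, x ∈ V ∨ ∃ (W' : X.Opens) (i : W' ⟶ W),
      x ∈ W' ∧ res i m = 0 := Iff.rfl

/-- The restriction `M|V` extended by zero, as a subsheaf of `M`. -/
def extendByZero (M : A.Mod) (V : X.Opens) : A.Mod where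
  val := (supportedSubmodule M V).toPresheafOfModules
  isSheaf := by
    refine (TopCat.Presheaf.isSheaf_iff_isSheafUniqueGluing (X := X.toTopCat) _).2 ?_
    intro ι W s hs
    obtain ⟨t, ht, huniq⟩ := TopCat.Sheaf.existsUnique_gluing (X := X.toTopCat)
      ⟨M.val.presheaf, M.isSheaf⟩ W (fun k => (s k).1)
      (fun k l => congrArg Subtype.val (hs k l))
    refine ⟨⟨t, ?_⟩, fun k => Subtype.ext (ht k), fun t' ht' => Subtype.ext
      (huniq _ fun k => congrArg Subtype.val (ht' k))⟩
    refine mem_supportedSubmodule.2 fun x hx => ?_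
    obtain ⟨k, hk⟩ := Opens.mem_iSup.1 hx
    rcases mem_supportedSubmodule.1 (s k).2 x hk with h | ⟨W₁, i₁, h₁, e₁⟩
    · exact Or.inl h
    refine Or.inr ⟨W₁, i₁ ≫ Opens.leSupr W k, h₁, ?_⟩
    exact (res_res i₁ (Opens.leSupr W k) (show M.val.obj (op (iSup W)) from t)).symm.trans
      ((congrArg (res i₁) (ht k)).trans e₁)

/-- The inclusion of `M|V`, extended by zero, in `M`. -/
def extendByZeroι (M : A.Mod) (V : X.Opens) : extendByZero M V ⟶ M :=
  ⟨(supportedSubmodule M V).ι⟩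

instance (V : X.Opens) : Mono (extendByZeroι M V) :=
  (SheafOfModules.forget A.sheaf).mono_of_mono_map
    (inferInstanceAs (Mono (supportedSubmodule M V).ι))

/-- The section `n` is the image of `m` under the extension of `φ` by zero: `n = φ(m)` on `V`, and
near points outside `V` both vanish. -/
def IsZeroExtension {V : X.Opens} (φ : HomOver M N V) {W : X.Opens} (m : M.val.obj (op W))
    (n : N.val.obj (op W)) : Prop :=
  (∀ (W' : X.Opens) (j : W' ⟶ W) (i : W' ⟶ V), res j n = φ.eval i (res j m)) ∧
    ∀ x ∈ W, x ∈ V ∨ ∃ (W' : X.Opens) (i : W' ⟶ W), x ∈ W' ∧ res i m = 0 ∧ res i n = 0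

namespace IsZeroExtension
variable {V : X.Opens} {φ : HomOver M N V} {W : X.Opens} {m m' : M.val.obj (op W)}
  {n n' : N.val.obj (op W)}

theorem add (h : IsZeroExtension φ m n) (h' : IsZeroExtension φ m' n') :
    IsZeroExtension φ (m + m') (n + n') := by
  refine ⟨fun W' j i => by rw [res_add, res_add, map_add, h.1 _ j i, h'.1 _ j i], fun x hx => ?_⟩
  rcases h.2 x hx with h | ⟨W₁, i₁, h₁, e₁, e₁'⟩
  · exact Or.inl h
  rcases h'.2 x hx with h | ⟨W₂, i₂, h₂, e₂, e₂'⟩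
  · exact Or.inl h
  refine Or.inr ⟨W₁ ⊓ W₂, homOfLE inf_le_left ≫ i₁, ⟨h₁, h₂⟩, ?_, ?_⟩
  · rw [res_add, ← res_res, e₁, res_zero, zero_add]
    change res (homOfLE inf_le_right ≫ i₂) _ = _
    rw [← res_res, e₂, res_zero]
  · rw [res_add, ← res_res, e₁', res_zero, zero_add]
    change res (homOfLE inf_le_right ≫ i₂) _ = _
    rw [← res_res, e₂', res_zero]

theorem smul (a : A.sheaf.obj.obj (op W)) (h : IsZeroExtension φ m n) :
    IsZeroExtension φ (a • m) (a • n) := by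
  refine ⟨fun W' j i => by rw [res_smul, res_smul, map_smul, h.1 _ j i], fun x hx => ?_⟩
  rcases h.2 x hx with h | ⟨W₁, i₁, h₁, e₁, e₁'⟩
  · exact Or.inl h
  exact Or.inr ⟨W₁, i₁, h₁, by rw [res_smul, e₁, smul_zero], by rw [res_smul, e₁', smul_zero]⟩

theorem res {W' : X.Opens} (j : W' ⟶ W) (h : IsZeroExtension φ m n) :
    IsZeroExtension φ (res j m) (res j n) := by
  refine ⟨fun W'' k i => by rw [res_res, res_res, h.1 _ _ i], fun x hx => ?_⟩
  rcases h.2 x (j.le hx) with h | ⟨W₁, i₁, h₁, e₁, e₁'⟩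
  · exact Or.inl h
  refine Or.inr ⟨W₁ ⊓ W', homOfLE inf_le_right, ⟨h₁, hx⟩, ?_, ?_⟩
  · rw [res_res]
    change AzumayaDet.res (homOfLE inf_le_left ≫ i₁) _ = _
    rw [← res_res, e₁, res_zero]
  · rw [res_res]
    change AzumayaDet.res (homOfLE inf_le_left ≫ i₁) _ = _
    rw [← res_res, e₁', res_zero]

theorem unique (h : IsZeroExtension φ m n) (h' : IsZeroExtension φ m n') : n = n' := by
  refine eq_of_locally_eq _ _ fun x hx => ?_
  by_cases hV : x ∈ V
  · exact ⟨W ⊓ V, homOfLE inf_le_left, ⟨hx, hV⟩,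
      (h.1 _ _ (homOfLE inf_le_right)).trans (h'.1 _ _ (homOfLE inf_le_right)).symm⟩
  obtain ⟨W₁, i₁, h₁, e₁, e₁'⟩ := (h.2 x hx).resolve_left hV
  obtain ⟨W₂, i₂, h₂, e₂, e₂'⟩ := (h'.2 x hx).resolve_left hV
  refine ⟨W₁ ⊓ W₂, homOfLE inf_le_left ≫ i₁, ⟨h₁, h₂⟩, ?_⟩
  rw [← res_res, e₁', res_zero]
  change _ = AzumayaDet.res (homOfLE inf_le_right ≫ i₂) _
  rw [← res_res, e₂', res_zero]

theorem exists_of_mem (φ : HomOver M N V) (hm : m ∈ (supportedSubmodule M V).obj (op W)) :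
    ∃ n, IsZeroExtension φ m n := by
  -- near a point of `V` take `φ(m)`, near any other point take `0`
  have loc (x : (W : Set X)) : ∃ (W' : X.Opens) (j : W' ⟶ W) (n : N.val.obj (op W')), x.1 ∈ W' ∧
      (∀ (W'' : X.Opens) (k : W'' ⟶ W') (i : W'' ⟶ V),
        AzumayaDet.res k n = φ.eval i (AzumayaDet.res (k ≫ j) m)) ∧
      (W' ≤ V ∨ AzumayaDet.res j m = 0 ∧ n = 0) := by
    rcases mem_supportedSubmodule.1 hm x.1 x.2 with h | ⟨W', j, h, e⟩
    · refine ⟨W ⊓ V, homOfLE inf_le_left,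
        φ.eval (homOfLE inf_le_right) (AzumayaDet.res (homOfLE inf_le_left) m), ⟨x.2, h⟩,
        fun W'' k i => ?_, Or.inl inf_le_right⟩
      rw [← φ.eval_res k _ i, res_res]
    · refine ⟨W', j, 0, h, fun W'' k i => ?_, Or.inr ⟨e, rfl⟩⟩
      rw [res_zero, ← res_res, e, res_zero, map_zero]
  choose W' j n hx h₁ h₂ using loc
  obtain ⟨s, hs⟩ := exists_glue (M := N) (ι := (W : Set X)) (U := W) j
    (fun x hx' => ⟨⟨x, hx'⟩, hx _⟩) n (by
    intro x y
    by_cases hV : W' x ⊓ W' y ≤ V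
    · rw [h₁ x _ _ (homOfLE hV), h₁ y _ _ (homOfLE hV)]
      rfl
    · rw [((h₂ x).resolve_left fun h => hV (inf_le_left.trans h)).2,
        ((h₂ y).resolve_left fun h => hV (inf_le_right.trans h)).2, res_zero, res_zero])
  refine ⟨s, fun U k i => ?_, fun x hx' => ?_⟩
  · refine eq_of_locally_eq _ _ fun x hxU => ?_
    let y : (W : Set X) := ⟨x, k.le hxU⟩
    refine ⟨W' y ⊓ U, homOfLE inf_le_right, ⟨hx y, hxU⟩, ?_⟩
    rw [res_res]
    change AzumayaDet.res (homOfLE inf_le_left ≫ j y) _ = _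
    rw [← res_res, hs, h₁ y _ _ (homOfLE inf_le_right ≫ i),
      ← φ.eval_res _ i (homOfLE inf_le_right ≫ i), res_res]
    rfl
  · rcases h₂ ⟨x, hx'⟩ with h | ⟨h, h'⟩
    · exact Or.inl (h (hx _))
    · exact Or.inr ⟨_, j ⟨x, hx'⟩, hx _, h, (hs _).trans h'⟩

end IsZeroExtension

/-- A homomorphism `M|V → N|V` extends by zero. -/
theorem exists_hom_extendByZero {V : X.Opens} (φ : HomOver M N V) :
    ∃ ψ : extendByZero M V ⟶ N, ∀ (W : X.Opens) (m : (extendByZero M V).val.obj (op W)),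
      IsZeroExtension φ (app (extendByZeroι M V) W m) (app ψ W m) := by
  choose f hf using fun (W : X.Opensᵒᵖ) (m : (extendByZero M V).val.obj W) =>
    IsZeroExtension.exists_of_mem (W := W.unop) φ m.2
  refine ⟨⟨PresheafOfModules.homMk
    { app := fun W => AddCommGrpCat.ofHom (AddMonoidHom.mk' (f W) fun m m' =>
        (hf W (m + m')).unique ((hf W m).add (hf W m')))
      naturality := fun W W' i => ?_ }
    fun W a m => (hf W (a • m)).unique ((hf W m).smul a)⟩, fun W m => hf _ m⟩
  ext m
  exact (hf W' _).unique ((hf W m).res i.unop)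

/-- Local homomorphisms into an injective `A`-module extend. -/
theorem homAbFunctor_isFlasque (M I : A.Mod) [Injective I] :
    TopCat.Sheaf.IsFlasque (X := X.toTopCat) ((homAbFunctor M).obj I) where
  epi {U V} i := by
    refine (AddCommGrpCat.epi_iff_surjective _).2 fun (φ : HomOver M I V.unop) => ?_
    obtain ⟨ψ, hψ⟩ := exists_hom_extendByZero φ
    let g : M ⟶ I := Injective.factorThru ψ (extendByZeroι M V.unop)
    have hg : extendByZeroι M V.unop ≫ g = ψ := Injective.comp_factorThru _ _
    refine ⟨(SheafOfModules.Hom.over g U.unop : HomOver M I U.unop),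
      HomOver.ext_eval (A := A) (M := M) (N := I) fun W j m => ?_⟩
    change app g W m = φ.eval j m
    have hm : m ∈ (supportedSubmodule M V.unop).obj (op W) := fun x hx => Or.inl (j.le hx)
    have h := (hψ W ⟨m, hm⟩).1 W (𝟙 W) j
    rw [res_id, res_id] at h
    rw [← hg] at h
    exact h

end extendByZero

/-! ### Splitting idempotents near a point -/

/-- Finitely many germs at a point come from sections over a common neighbourhood. -/
theorem exists_forall_germ_eq {κ : Type*} [Finite κ] {x : X} (U : X.Opens) (hx : x ∈ U)
    (r : κ → X.presheaf.stalk x) :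
    ∃ (W : X.Opens) (_ : W ⟶ U) (hW : x ∈ W) (s : κ → Γ(X, W)),
      ∀ k, (X.presheaf.germ W x hW).hom (s k) = r k := by
  choose V hV s hs using fun k => TopCat.Presheaf.exists_germ_eq (X := X.toTopCat) X.presheaf (r k)
  cases nonempty_fintype κ
  have hW : x ∈ U ⊓ Finset.univ.inf V := by
    refine ⟨hx, ?_⟩
    rw [TopologicalSpace.Opens.coe_finset_inf]
    simp [hV]
  refine ⟨U ⊓ Finset.univ.inf V, homOfLE inf_le_left, hW, fun k => (X.presheaf.map
    (homOfLE (inf_le_right.trans (Finset.inf_le (Finset.mem_univ k)))).op).hom (s k), fun k => ?_⟩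
  exact (TopCat.Presheaf.germ_res_apply X.presheaf _ _ _ _).trans (hs k)

/-- Finitely many equations between germs at a point hold in a neighbourhood. -/
theorem exists_forall_map_eq {κ : Type*} [Finite κ] {x : X} {U : X.Opens} (hx : x ∈ U)
    (s t : κ → Γ(X, U))
    (h : ∀ k, (X.presheaf.germ U x hx).hom (s k) = (X.presheaf.germ U x hx).hom (t k)) :
    ∃ (W : X.Opens) (i : W ⟶ U), x ∈ W ∧
      ∀ k, (X.presheaf.map i.op).hom (s k) = (X.presheaf.map i.op).hom (t k) := by
  choose V hV i j e using fun k =>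
    TopCat.Presheaf.germ_eq (X := X.toTopCat) X.presheaf x hx hx _ _ (h k)
  cases nonempty_fintype κ
  have hW : x ∈ U ⊓ Finset.univ.inf V := by
    refine ⟨hx, ?_⟩
    rw [TopologicalSpace.Opens.coe_finset_inf]
    simp [hV]
  refine ⟨_, homOfLE inf_le_left, hW, fun k => ?_⟩
  let l : U ⊓ Finset.univ.inf V ⟶ V k :=
    homOfLE (inf_le_right.trans (Finset.inf_le (Finset.mem_univ k)))
  have := congrArg (X.presheaf.map l.op).hom (e k)
  have hc (r : Γ(X, U)) (i : V k ⟶ U) : (X.presheaf.map l.op).hom ((X.presheaf.map i.op).hom r) =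
      (X.presheaf.map (homOfLE inf_le_left : U ⊓ Finset.univ.inf V ⟶ U).op).hom r := by
    change _ = (X.presheaf.map (l ≫ i).op).hom r
    rw [op_comp, X.presheaf.map_comp]
    rfl
  exact (hc _ (i k)).symm.trans (this.trans (hc _ (j k)))

/-- An idempotent matrix of functions splits through a free module near each point. -/
theorem exists_local_splitting {ι : Type} [Fintype ι] [DecidableEq ι] {U : X.Opens} {x : X}
    (hx : x ∈ U) (e : Matrix ι ι Γ(X, U)) (he : e * e = e) :
    ∃ (W : X.Opens) (i : W ⟶ U), x ∈ W ∧ ∃ (n : ℕ) (Q : Matrix ι (Fin n) Γ(X, W))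
      (P : Matrix (Fin n) ι Γ(X, W)), Q * P = e.map (X.presheaf.map i.op).hom ∧ P * Q = 1 := by
  obtain ⟨n, Q, P, hQP, hPQ⟩ := Matrix.exists_mul_eq_of_isIdempotentElem
    (e.map (X.presheaf.germ U x hx).hom) (by rw [← Matrix.map_mul, he])
  obtain ⟨W₁, i₁, h₁, s, hs⟩ := exists_forall_germ_eq U hx
    (Sum.elim (fun p : ι × Fin n => Q p.1 p.2) (fun p : Fin n × ι => P p.1 p.2))
  let Q₁ : Matrix ι (Fin n) Γ(X, W₁) := Matrix.of fun a b => s (Sum.inl (a, b))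
  let P₁ : Matrix (Fin n) ι Γ(X, W₁) := Matrix.of fun a b => s (Sum.inr (a, b))
  have hQ₁ : Q₁.map (X.presheaf.germ W₁ x h₁).hom = Q := by
    ext a b; exact hs (Sum.inl (a, b))
  have hP₁ : P₁.map (X.presheaf.germ W₁ x h₁).hom = P := by
    ext a b; exact hs (Sum.inr (a, b))
  have h1 : (Q₁ * P₁).map (X.presheaf.germ W₁ x h₁).hom =
      (e.map (X.presheaf.map i₁.op).hom).map (X.presheaf.germ W₁ x h₁).hom := by
    rw [Matrix.map_mul, hQ₁, hP₁, hQP]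
    ext a b
    exact (TopCat.Presheaf.germ_res_apply X.presheaf i₁ x h₁ (e a b)).symm
  have h2 : (P₁ * Q₁).map (X.presheaf.germ W₁ x h₁).hom =
      (1 : Matrix (Fin n) (Fin n) Γ(X, W₁)).map (X.presheaf.germ W₁ x h₁).hom := by
    rw [Matrix.map_mul, hQ₁, hP₁, hPQ, Matrix.map_one _ (map_zero _) (map_one _)]
  obtain ⟨W, i, hW, h⟩ := exists_forall_map_eq h₁
    (Sum.elim (fun p : ι × ι => (Q₁ * P₁) p.1 p.2) (fun p : Fin n × Fin n => (P₁ * Q₁) p.1 p.2))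
    (Sum.elim (fun p : ι × ι => e.map (X.presheaf.map i₁.op).hom p.1 p.2)
      (fun p : Fin n × Fin n => (1 : Matrix (Fin n) (Fin n) Γ(X, W₁)) p.1 p.2)) (by
    rintro (⟨a, b⟩ | ⟨a, b⟩)
    · exact congrFun (congrFun h1 a) b
    · exact congrFun (congrFun h2 a) b)
  refine ⟨W, i ≫ i₁, hW, n, Q₁.map (X.presheaf.map i.op).hom, P₁.map (X.presheaf.map i.op).hom,
    ?_, ?_⟩
  · rw [← Matrix.map_mul]
    ext a b
    refine (h (Sum.inl (a, b))).trans ?_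
    rw [op_comp, X.presheaf.map_comp]
    rfl
  · rw [← Matrix.map_mul, ← Matrix.map_one (X.presheaf.map i.op).hom (map_zero _) (map_one _)]
    ext a b
    exact h (Sum.inr (a, b))

/-- A dual basis whose matrix of coordinates splits as `Q * P` with `P * Q = 1` can be replaced by a
basis, namely the sections `P * s` with the functionals `f * Q`. -/
theorem DualBasis.nonempty_iso_free_of_splitting {ι : Type} [Fintype ι] {M : A.Mod} {U : X.Opens}
    (b : DualBasis ι M U) {n : ℕ} (Q : Matrix ι (Fin n) (A.sheaf.obj.obj (op U)))
    (P : Matrix (Fin n) ι (A.sheaf.obj.obj (op U)))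
    (hQP : Q * P = Matrix.of fun i j => (b.f j).coord (𝟙 U) (b.s i)) (hPQ : P * Q = 1) :
    Nonempty (M.over U ≅ SheafOfModules.free (R := A.sheaf.over U) (ULift.{u} (Fin n))) := by
  let f (l : Fin n) : HomOver M (SheafOfModules.unit A.sheaf) U :=
    ∑ i, (b.f i ≫ HomOver.ofSection (M := SheafOfModules.unit A.sheaf) (Q i l))
  have hf (l : Fin n) {W : X.Opens} (j : W ⟶ U) (m : M.val.obj (op W)) :
      (f l).coord j m = ∑ i, (b.f i).coord j m * A.sheaf.obj.map j.op (Q i l) :=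
    HomOver.eval_sum _ _ j m
  let s (l : Fin n) : M.val.obj (op U) := ∑ i, P l i • b.s i
  have hs (i : ι) : ∑ j, (Q * P) i j • b.s j = b.s i := by
    have := b.sum_smul (𝟙 U) (b.s i)
    simpa only [hQP, Matrix.of_apply, res_id] using this
  refine DualBasis.nonempty_iso_free (b := ⟨s, f, fun {W} j m => ?_⟩) fun k l => ?_
  · change ∑ l, (f l).coord j m • res j (s l) = m
    have hs' (i : ι) : ∑ l, (A.sheaf.obj.map j.op (Q i l) : A.sheaf.obj.obj (op W)) • res j (s l) =
        res j (b.s i) := by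
      rw [← hs i, res_sum]
      simp only [s, Matrix.mul_apply, Finset.sum_smul, mul_smul]
      rw [Finset.sum_congr rfl fun l _ => (res_smul (M := M) j (Q i l) (s l)).symm, ← res_sum]
      simp only [s, Finset.smul_sum]
      rw [Finset.sum_comm, res_sum]
    simp only [hf, Finset.sum_smul, mul_smul]
    rw [Finset.sum_comm]
    simp only [← Finset.smul_sum, hs']
    exact b.sum_smul j m
  · change (f k).coord (𝟙 U) (s l) = _
    rw [hf]
    have hid (r : A.sheaf.obj.obj (op U)) : A.sheaf.obj.map (𝟙 U).op r = r := by
      rw [op_id, A.sheaf.obj.map_id]; rfl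
    have h1 (i : ι) : (b.f i).coord (𝟙 U) (s l) = (P * (Q * P)) l i := by
      simp only [s, map_sum, map_smul, smul_eq_mul, Matrix.mul_apply (M := P), hQP, Matrix.of_apply]
    simp only [h1, hid]
    rw [← Matrix.mul_apply, ← Matrix.mul_assoc, hPQ, Matrix.one_mul, hPQ, Matrix.one_apply]

/-! ### Local freeness of `ℋom_A(M, N)` -/

/-- The structure sheaf as an algebra over itself; its modules are the `𝒪_X`-modules. -/
def structureAlgebra (X : Scheme.{u}) : OAlgebra X where
  sheaf := X.ringCatSheaf
  unit := 𝟙 _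
  central U r a := mul_comm (G := Γ(X, U)) r a

/-- An `𝒪_X`-module as a module over the algebra `𝒪_X`. -/
def asModule (E : X.Modules) : (structureAlgebra X).Mod :=
  show SheafOfModules X.ringCatSheaf from E

/-- A locally projective `𝒪_X`-module is locally free. -/
theorem isLocallyFreeOfFiniteRank_of_isLocallyProjective (E : X.Modules)
    (hE : IsLocallyProjective (asModule E)) : IsLocallyFreeOfFiniteRank E := fun x => by
  obtain ⟨U, n, hx, ⟨b⟩⟩ := hE x
  let e : Matrix (Fin n) (Fin n) Γ(X, U) := Matrix.of fun i j => (b.f j).coord (𝟙 U) (b.s i)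
  have he : e * e = e := by
    ext i k
    have h := congrArg ((b.f k).coord (𝟙 U)) (b.sum_smul (𝟙 U) (b.s i))
    simp only [map_sum, map_smul] at h
    refine (Matrix.mul_apply ..).trans (Eq.trans (Finset.sum_congr rfl fun j _ => ?_) h)
    exact congrArg (fun t => (b.f j).coord (𝟙 U) (b.s i) • (b.f k).coord (𝟙 U) t)
      (res_id (b.s j)).symm
  obtain ⟨W, i, hW, m, Q, P, hQP, hPQ⟩ := exists_local_splitting hx e he
  refine ⟨W, hW, m, (b.restrict i).nonempty_iso_free_of_splitting Q P ?_ hPQ⟩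
  refine hQP.trans ?_
  ext k l
  exact ((b.f l).coord_naturality i (𝟙 U) (b.s k)).symm

/-- On the `𝒪_X`-module underlying an `A`-module, a function acts through its image in `A`. -/
theorem toOModules_smul {M : A.Mod} {W : X.Opens} (r : Γ(X, W)) (m : M.val.obj (op W)) :
    (show (asModule (A.toOModules.obj M)).val.obj (op W) from
      (show (structureAlgebra X).sheaf.obj.obj (op W) from r) •
        (show (asModule (A.toOModules.obj M)).val.obj (op W) from m)) =
      HomOver.scalar A (𝟙 W) r • m := by
  unfold HomOver.scalar
  rw [op_id, X.presheaf.map_id]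
  rfl

/-- Renumbering of a dual basis. -/
def DualBasis.reindex {ι κ : Type} [Fintype ι] [Fintype κ] {M : A.Mod} {U : X.Opens}
    (b : DualBasis ι M U) (e : ι ≃ κ) : DualBasis κ M U where
  s k := b.s (e.symm k)
  f k := b.f (e.symm k)
  sum_smul i m := (e.symm.sum_comp (fun k => (b.f k).coord i m • res i (b.s k))).trans
    (b.sum_smul i m)

section homSheaf
variable {ι κ l : Type} [Fintype ι] [Fintype κ] [Fintype l] {M N : A.Mod} {U : X.Opens}

/-- The functional `φ ↦ h (g (φ m))` on `ℋom_A(M, N)`. -/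
def homFunctional (m : M.val.obj (op U)) (g : HomOver N (SheafOfModules.unit A.sheaf) U)
    (h : HomOver (asModule (A.toOModules.obj (SheafOfModules.unit A.sheaf)))
      (SheafOfModules.unit (structureAlgebra X).sheaf) U) :
    HomOver (asModule (homSheaf M N)) (SheafOfModules.unit (structureAlgebra X).sheaf) U :=
  HomOver.mk (fun W i =>
    { toFun := fun (φ : HomOver M N W) => h.coord i (g.coord i (φ.eval (𝟙 W) (res i m)))
      map_add' := fun (φ ψ : HomOver M N W) =>
        (congrArg (h.coord i) (map_add (g.coord i) _ _)).trans (map_add (h.coord i) _ _)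
      map_smul' := fun r (φ : HomOver M N W) => by
        change h.coord i (g.coord i ((HomOver.scalar A (𝟙 W) r) • φ.eval (𝟙 W) (res i m))) = _
        rw [map_smul]
        refine Eq.trans ?_ ((h.coord i).map_smul r _)
        exact congrArg (h.coord i) (toOModules_smul (M := SheafOfModules.unit A.sheaf) r _).symm })
    (fun W W' j i (φ : HomOver M N W) => by
      change h.coord (j ≫ i)
          (g.coord (j ≫ i) ((HomOver.restrict j φ).eval (𝟙 W') (res (j ≫ i) m))) =
        X.ringCatSheaf.obj.map j.op (h.coord i (g.coord i (φ.eval (𝟙 W) (res i m))))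
      refine Eq.trans ?_ (h.coord_naturality j i _)
      congr 1
      refine Eq.trans ?_ (g.coord_naturality j i _)
      congr 1
      rw [← φ.eval_res j (𝟙 W) j, res_res]
      rfl)

/-- A dual basis of `A` over `𝒪_X`, with the coefficients viewed in `A`. -/
theorem DualBasis.sum_scalar_mul
    (d : DualBasis l (asModule (A.toOModules.obj (SheafOfModules.unit A.sheaf))) U) {W : X.Opens}
    (i : W ⟶ U) (α : A.sheaf.obj.obj (op W)) :
    ∑ k, HomOver.scalar A (𝟙 W) ((d.f k).coord i α) *
      (A.sheaf.obj.map i.op (d.s k) : A.sheaf.obj.obj (op W)) = α := by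
  refine Eq.trans ?_ (d.sum_smul i α)
  exact Finset.sum_congr rfl fun k _ =>
    (toOModules_smul (M := SheafOfModules.unit A.sheaf) _ _).symm

/-- An `𝒪_X`-linear functional on `A`, with values viewed in `A`, commutes with restriction. -/
theorem scalar_coord (h : HomOver (asModule (A.toOModules.obj (SheafOfModules.unit A.sheaf)))
      (SheafOfModules.unit (structureAlgebra X).sheaf) U) {V W : X.Opens} (j : V ⟶ W) (i : W ⟶ U)
    (α : A.sheaf.obj.obj (op W)) :
    HomOver.scalar A j (h.coord i α) =
      HomOver.scalar A (𝟙 V) (h.coord (j ≫ i) (A.sheaf.obj.map j.op α)) := by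
  refine Eq.trans ?_ (congrArg (HomOver.scalar A (𝟙 V)) (h.coord_naturality j i α)).symm
  unfold HomOver.scalar
  rw [op_id, X.presheaf.map_id]
  rfl

/-- If `M` and `N` have dual bases over `A`, and `A` has one over `𝒪_X`, then `ℋom_A(M, N)` has one
over `𝒪_X`: a homomorphism is determined by its values on the sections of `b`, these are expanded
along `c`, and the resulting coefficients in `A` along `d`. -/
def DualBasis.hom (b : DualBasis ι M U) (c : DualBasis κ N U)
    (d : DualBasis l (asModule (A.toOModules.obj (SheafOfModules.unit A.sheaf))) U) :
    DualBasis (ι × κ × l) (asModule (homSheaf M N)) U where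
  s k := (b.f k.1 ≫ HomOver.ofSection ((show A.sheaf.obj.obj (op U) from d.s k.2.2) • c.s k.2.1) :
    HomOver M N U)
  f k := homFunctional (b.s k.1) (c.f k.2.1) (d.f k.2.2)
  sum_smul {W} i (φ : HomOver M N W) := by
    let r (k : ι × κ × l) : Γ(X, W) := (d.f k.2.2).coord i ((c.f k.2.1).coord i
      (φ.eval (𝟙 W) (res i (b.s k.1))))
    let σ (k : ι × κ × l) : HomOver M N W := HomOver.restrict i
      (b.f k.1 ≫ HomOver.ofSection ((show A.sheaf.obj.obj (op U) from d.s k.2.2) • c.s k.2.1) :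
        HomOver M N U)
    change ∑ k, r k • σ k = φ
    refine HomOver.ext_eval fun V j m => ?_
    rw [HomOver.eval_sum, (b.restrict i).eval_eq φ j m, Fintype.sum_prod_type]
    refine Finset.sum_congr rfl fun a _ => ?_
    rw [Fintype.sum_prod_type]
    let F : A.sheaf.obj.obj (op V) := (b.f a).coord (j ≫ i) m
    let n : N.val.obj (op W) := φ.eval (𝟙 W) (res i (b.s a))
    change ∑ x, ∑ y, HomOver.scalar A j ((d.f y).coord i ((c.f x).coord i n)) •
      F • res (j ≫ i) ((show A.sheaf.obj.obj (op U) from d.s y) • c.s x) = F • res j n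
    rw [← c.sum_smul (j ≫ i) (res j n), Finset.smul_sum]
    refine Finset.sum_congr rfl fun x _ => ?_
    conv_rhs => rw [← d.sum_scalar_mul (j ≫ i) ((c.f x).coord (j ≫ i) (res j n)), Finset.sum_smul,
      Finset.smul_sum]
    refine Finset.sum_congr rfl fun y _ => ?_
    have comm (s t t' : A.sheaf.obj.obj (op V)) (v : N.val.obj (op V)) (h : s * t = t * s) :
        s • t • t' • v = t • (s * t') • v := by
      rw [smul_smul, h, mul_smul, mul_smul]
    -- functions are central in `A`, so the coefficients along `A` pass the coordinates of `m`
    rw [res_smul, scalar_coord, ← (c.f x).coord_naturality j i]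
    exact comm _ _ _ _ (HomOver.scalar_commute _ _ _)

end homSheaf

/-- `ℋom_A(M, N)` is locally free for locally projective modules over an algebra which is locally
free over `𝒪_X`. -/
theorem isLocallyFreeOfFiniteRank_homSheaf {M N : A.Mod} (hM : IsLocallyProjective M)
    (hN : IsLocallyProjective N)
    (hA : IsLocallyFreeOfFiniteRank (A.toOModules.obj (SheafOfModules.unit A.sheaf))) :
    IsLocallyFreeOfFiniteRank (homSheaf M N) := by
  refine isLocallyFreeOfFiniteRank_of_isLocallyProjective _ fun x => ?_
  obtain ⟨U₁, m, h₁, ⟨b⟩⟩ := hM x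
  obtain ⟨U₂, n, h₂, ⟨c⟩⟩ := hN x
  obtain ⟨U₃, h₃, p, ⟨e⟩⟩ := hA x
  have d : DualBasis (Fin p) (asModule (A.toOModules.obj (SheafOfModules.unit A.sheaf))) U₃ :=
    DualBasis.ofRetract (Retract.ofIso e)
  have := ((b.restrict (homOfLE (inf_le_left.trans inf_le_left) : U₁ ⊓ U₂ ⊓ U₃ ⟶ U₁)).hom
    (c.restrict (homOfLE (inf_le_left.trans inf_le_right) : U₁ ⊓ U₂ ⊓ U₃ ⟶ U₂))
    (d.restrict (homOfLE inf_le_right)))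
  exact ⟨U₁ ⊓ U₂ ⊓ U₃, _, ⟨⟨h₁, h₂⟩, h₃⟩, ⟨this.reindex (Fintype.equivFin _)⟩⟩

/-! ### Global sections and the first Ext group -/

/-- A homomorphism is the same as a global section of the sheaf of homomorphisms. -/
theorem homToH0_bijective (M N : A.Mod) : Function.Bijective (homToH0 M N) := by
  refine (CategoryTheory.Sheaf.H.equiv₀ ((toAbSheaf X).obj (homSheaf M N))
    (Limits.isTerminalTop : Limits.IsTerminal (⊤ : Opens X))).symm.bijective.comp
      ⟨fun f g h => ?_, fun φ => ?_⟩
  · apply SheafOfModules.hom_ext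
    apply PresheafOfModules.hom_ext
    rintro ⟨W⟩
    apply ModuleCat.hom_ext
    apply LinearMap.ext
    intro m
    exact congrArg (fun ψ : HomOver M N ⊤ => ψ.eval (homOfLE le_top : W ⟶ ⊤) m) h
  · change HomOver M N ⊤ at φ
    refine ⟨⟨PresheafOfModules.homMk
      { app := fun W => AddCommGrpCat.ofHom
          (φ.eval (homOfLE le_top : W.unop ⟶ ⊤)).toAddMonoidHom
        naturality := fun W W' i => ?_ }
      fun W a m => (φ.eval (homOfLE le_top : W.unop ⟶ ⊤)).map_smul a m⟩, ?_⟩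
    · ext m
      exact φ.eval_res i.unop _ _ m
    · exact HomOver.ext_eval (A := A) (M := M) (N := N) fun W i m => rfl

theorem homToH0_comp (M : A.Mod) {N P : A.Mod} (f : N ⟶ P) (φ : M ⟶ N) :
    homToH0 M P (φ ≫ f) =
      (homToH0 M N φ).comp (Abelian.Ext.mk₀ ((homAbFunctor M).map f)) (zero_add 0) :=
  (CategoryTheory.Sheaf.H.equiv₀_symm_naturality
    (Limits.isTerminalTop : Limits.IsTerminal (⊤ : Opens X)) ((homAbFunctor M).map f)
    (show ((homAbFunctor M).obj N).obj.obj (op ⊤) from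
      (SheafOfModules.Hom.over φ (⊤ : X.Opens) : HomOver M N ⊤))).symm

theorem ext_one_homAbFunctor_eq_zero (M I : A.Mod) [Injective I]
    (x : Cohomology (homSheaf M I) 1) : x = 0 :=
  TopCat.Sheaf.IsFlasque.ext_one_eq_zero _ (homAbFunctor_isFlasque M I) x

/-- `Ext¹_A(M, -)` is the first cohomology of `ℋom_A(M, -)`, compatibly with connecting
homomorphisms. -/
theorem exists_extEquiv {M : A.Mod} (hM : IsLocallyProjective M) (N : A.Mod) :
    ∃ e : ExtGroup M N 1 ≃+ Cohomology (homSheaf M N) 1,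
      ∀ (P Q : A.Mod) (i : N ⟶ P) (p : P ⟶ Q) (w : i ≫ p = 0)
        (hS : (ShortComplex.mk i p w).ShortExact) (φ : M ⟶ Q),
        e ((Abelian.Ext.mk₀ φ).comp hS.extClass (zero_add 1)) =
          Abelian.Ext.comp (homToH0 M Q φ) (homAbFunctor_shortExact hM hS).extClass
            (zero_add 1) := by
  have := SheafOfModules.enoughInjectives A.sheaf
  exact Abelian.Ext.exists_addEquiv_one_of_effaceable (homAbFunctor M) M
    ((constantSheaf (Opens.grothendieckTopology X) AddCommGrpCat.{u}).obj
      (AddCommGrpCat.of (ULift ℤ)))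
    (homToH0 M) (homToH0_bijective M) (homToH0_comp M) (homAbFunctor_shortExact hM)
    (fun I _ x => ext_one_homAbFunctor_eq_zero M I x) N

end
end AzumayaDet

open AzumayaDet in
theorem mainTheorem3 {X : Scheme.{0}} (π : X ⟶ Spec (CommRingCat.of ℤ))
    (hX : IsArithmeticSurface π) (A : OAlgebra X) (hA : A.IsAzumaya)
    (M N : A.Mod) (hM : A.IsAzumayaModule M) (hN : A.IsAzumayaModule N) :
    IsLocallyFreeOfFiniteRank (homSheaf M N) ∧
    ∃ (e₀ : (M ⟶ N) ≃+ Cohomology (homSheaf M N) 0)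
      (e₁ : ExtGroup M N 1 ≃+ Cohomology (homSheaf M N) 1)
      (Φ : pairDet M N ≃ₗ[ℤ] cohomologyDet (homSheaf M N)),
      (∀ φ : M ⟶ N, e₀ φ = homToH0 M N φ) ∧
      (∀ (P Q : A.Mod) (i : N ⟶ P) (p : P ⟶ Q) (w : i ≫ p = 0)
        (hS : (ShortComplex.mk i p w).ShortExact),
        ∃ hT : ((ShortComplex.mk i p w).map (homAbFunctor M)).ShortExact,
          ∀ φ : M ⟶ Q,
            e₁ ((Abelian.Ext.mk₀ φ).comp hS.extClass (zero_add 1)) =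
              Abelian.Ext.comp (homToH0 M Q φ) hT.extClass (zero_add 1)) ∧
      (∀ (a : detLine (M ⟶ N)) (b : Module.Dual ℤ (detLine (ExtGroup M N 1))),
        Φ (a ⊗ₜ[ℤ] b) = detCongr e₀ a ⊗ₜ[ℤ] (b ∘ₗ (detCongr e₁).symm.toLinearMap)) := by
  have hM' := hM.isLocallyProjective
  let e₀ := AddEquiv.ofBijective (homToH0 M N) (homToH0_bijective M N)
  exact (exists_extEquiv hM' N).elim fun e₁ he₁ =>
    ⟨isLocallyFreeOfFiniteRank_homSheaf hM' hN.isLocallyProjective hA.locallyFree, e₀, e₁,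
      TensorProduct.congr (detCongr e₀) (detCongr e₁).symm.dualMap, fun _ => rfl,
      fun P Q i p w hS => ⟨homAbFunctor_shortExact hM' hS, he₁ P Q i p w hS⟩, fun _ _ => rfl⟩
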